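/- **Linkages.** A marked linkage $\mathcal L=(L,\ell,W)$ with marking image $Z$ is a finite loopless graph $L$ with edge lengths $\ell>0$ and a list $W$ of fixed vertices with prescribed positions $Z$ in $\mathbb C=\mathbb R^2$. $C(\mathcal L)$ is the set of maps $\phi:\mathcal V(L)\to\mathbb C$ with $|\phi(v)-\phi(w)|^2=\ell[vw]^2$ for each edge $[vw]$ and $\phi(w_j)=z_j$ for the fixed vertices. $\mathfrak C(\mathcal L)$ is the affine $\mathbb R$-scheme defined by these equations; optionally, for a chosen list of degenerate triangles ($\ell[AC]=\ell[AB]+\ell[BC]$), the equations of $[AB]$ and $[BC]$ are replaced by $\phi(B)=\frac{\ell[BC]}{\ell[AC]}\phi(A)+\frac{\ell[AB]}{\ell[AC]}\phi(C)$. Given distinct input vertices $P_1,\dots,P_m$ and distinct output vertices $Q_1,\dots,Q_n$, let $p(\phi)=(\phi(P_i))_i$, $q(\phi)=(\phi(Q_j))_j$. **Functional linkages.** Let $\mathbf k\in\{\mathbb R,\mathbb C\}$, where $\mathbb R$ is the real axis in $\mathbb C$, and $F:\mathbf k^m\to\mathbb C^n$ (for instance with values in $\mathbf k^n$). $\mathcal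 L$ is $\mathbf k$-functional for $F$ with symmetry group $Sym(\mathcal L)$ if (a) $p$ takes values in $\mathbf k^m$, and $Dom(\mathcal L):=p(C(\mathcal L))$ has nonempty interior in $\mathbf k^m$; (b) $Sym(\mathcal L)$ is a finite group of bijections of $C(\mathcal L)$, each induced by an automorphism of $\mathfrak C(\mathcal L)$ that commutes with the morphisms $p$ and $q$; the fibers of $p$ are exactly the orbits of $Sym(\mathcal L)$, and $p:C(\mathcal L)\to Dom(\mathcal L)$ is a topological quotient map; (c) $q=F\circ p$; (d) the set $Wall(\mathcal L)$ of fixed points of nontrivial elements of $Sym(\mathcal L)$ is nowhere dense in $C(\mathcal L)$. So $p$ is a regular branched covering of $Dom(\mathcal L)$ with group $Sym(\mathcal L)$, branched along $Wall(\mathcal L)$. The theorem holds both when automorphisms are given by elements of the coordinate ring and when fractions with denominators nowhere zero on $C(\mathcal L)$ are allowed as well. $Crit(\mathcal L)$ is the set of $\phi\in C(\mathcal L)$ at which $p$ is not a local analytic isomorphism of $\mathfrak C(\mathcal L)$ to $\mathbf k^m$ in the scheme-theoretic sense (isomorphism of stalks of the real analytic structure sheaves), and $Dom^*(\mathcal L):=p(C(\mathcal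 L)\setminus Crit(\mathcal L))$. A functional linkage defines the germ of $F$ at each point of $Dom^*(\mathcal L)$. **Theorem (1st functionality theorem).** Let $\mathcal A$ be $\mathbb C$-functional for $f:\mathbb C^n\to\mathbb C^s$ and $\mathcal B$ be $\mathbf k$-functional for $g:\mathbf k^m\to\mathbb C^t$ (for instance with values in $\mathbf k^t$), with $t\le n$, and $t=n$ if $\mathbf k=\mathbb R$. Let $T=\{P_1,\dots,P_t\}$ be the first $t$ inputs of $\mathcal A$ and $Q_1,\dots,Q_t$ the outputs of $\mathcal B$. Let $\mathcal L$ be the fiber sum of $\mathcal A$ and $\mathcal B$ obtained by identifying $P_i$ with $Q_i$ for all $i$, with inputs $In(\mathcal B)\cup(In(\mathcal A)\setminus T)$ and outputs $Out(\mathcal A)$. Write $\eta=(\eta',\eta'')$ for the restrictions of $\eta\in C(\mathcal L)$ to $\mathcal A$ and $\mathcal B$; let $eval_T(\phi)=(\phi(P_1),\dots,\phi(P_t))$ on $C(\mathcal A)$, let $\pi_T(x)=(x_1,\dots,x_t)$, and let $q''$ be the output map of $\mathcal B$. Put $D:=Dom(\mathcal A)\times_{\pi_T=g}Dom(\mathcal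 B)=\{(x,y)\in Dom(\mathcal A)\times Dom(\mathcal B):\pi_T(x)=g(y)\}$. Assume that there is $(x,y)\in D$ with $x\in int\,Dom(\mathcal A)$ and $y\in int\,Dom(\mathcal B)$ (for $t=n$: $int\,Dom(\mathcal B)\cap g^{-1}(int\,Dom(\mathcal A))\neq\emptyset$). Let $D^\circ$ be the set of $(x,y)\in D$ such that $x$ is not in the image of $Wall(\mathcal A)$ under the input map of $\mathcal A$ and $y$ is not in the image of $Wall(\mathcal B)$ under the input map of $\mathcal B$. Then: 1. The restriction morphisms identify $\mathfrak C(\mathcal L)$ with the fiber product $\mathfrak C(\mathcal A)\times_{eval_T=q''}\mathfrak C(\mathcal B)$ over $(\mathbb A^2_{\mathbb R})^t$. 2. The map $(x,y)\mapsto(y_1,\dots,y_m,x_{t+1},\dots,x_n)$ is a semi-algebraic homeomorphism of $D$ onto $Dom(\mathcal L)$ (its graph is the trace of a semi-algebraic set on $D\times Dom(\mathcal L)$). The bijections $\sigma$ of $C(\mathcal L)$ for which there are $\sigma'\in Sym(\mathcal A)$, $\sigma''\in Sym(\mathcal B)$ with $\sigma(\eta)=(\sigma'(\eta'),\sigma''(\eta''))$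 for all $\eta$ form a group $Sym(\mathcal L)$, and with this group $\mathcal L$ satisfies (a), (b), (c) over $\mathbf k$ for $$h(y,x_{t+1},\dots,x_n)=f(g_1(y),\dots,g_t(y),x_{t+1},\dots,x_n).$$ If $D^\circ$ is dense in $D$, then also (d) holds, that is, $\mathcal L$ is $\mathbf k$-functional for $h$. 3. If $D^\circ\ne\emptyset$, then $Sym(\mathcal L)\cong Sym(\mathcal A)\times Sym(\mathcal B)$ by $\sigma\mapsto(\sigma',\sigma'')$. 4. If $D^\circ\ne\emptyset$, then $Wall(\mathcal L)=\big(Wall(\mathcal A)\times_{eval_T=q''}C(\mathcal B)\big)\cup\big(C(\mathcal A)\times_{eval_T=q''}Wall(\mathcal B)\big)$. 5. $Crit(\mathcal L)\subset\big(Crit(\mathcal A)\times_{eval_T=q''}C(\mathcal B)\big)\cup\big(C(\mathcal A)\times_{eval_T=q''}Crit(\mathcal B)\big)$. 6. If $x\in Dom^*(\mathcal A)$, $y\in Dom^*(\mathcal B)$ and $\pi_T(x)=g(y)$, then $(y,x_{t+1},\dots,x_n)\in Dom^*(\mathcal L)$. In particular, if $t=n$, then $Dom^*(\mathcal B)\cap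 g^{-1}(Dom^*(\mathcal A))\subset Dom^*(\mathcal L)$. -/

import Mathlib

open CategoryTheory AlgebraicGeometry Topology Filter

noncomputable section

/-! ## Marked linkages and their configuration schemes -/

/-- A finite marked linkage together with the positions of its fixed vertices.

* `(V, E)` is a finite graph without loops (parallel edges are allowed, since gluing may produce
  them) and `len` assigns a positive length to each edge;
* the fixed vertices are listed by `mark`, and `pos` is the image of the marking;
* `D` is a (possibly empty) list of degenerate triangles `ABC` of the linkage, with
  `ℓ[AC] = ℓ[AB] + ℓ[BC]`, whose equations are replaced by the linear equation saying that the
  bar `AC` carries the point `B`. -/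
structure MarkedLinkage where
  V : Type
  E : Type
  M : Type
  D : Type
  [fintypeV : Fintype V]
  [finiteE : Finite E]
  [finiteM : Finite M]
  [finiteD : Finite D]
  src : E → V
  tgt : E → V
  src_ne_tgt : ∀ e, src e ≠ tgt e
  len : E → ℝ
  len_pos : ∀ e, 0 < len e
  mark : M → V
  pos : M → ℂ
  triA : D → V
  triB : D → V
  triC : D → V
  sideAB : D → E
  sideBC : D → E
  sideAC : D → E
  joins_AB : ∀ d, s(src (sideAB d), tgt (sideAB d)) = s(triA d, triB d)
  joins_BC : ∀ d, s(src (sideBC d), tgt (sideBC d)) = s(triB d, triC d)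
  joins_AC : ∀ d, s(src (sideAC d), tgt (sideAC d)) = s(triA d, triC d)
  degenerate : ∀ d, len (sideAC d) = len (sideAB d) + len (sideBC d)

attribute [instance] MarkedLinkage.fintypeV MarkedLinkage.finiteE MarkedLinkage.finiteM
  MarkedLinkage.finiteD

/-- The two real coordinates of a complex number. -/
def planeCoord (z : ℂ) (j : Fin 2) : ℝ := if j = 0 then z.re else z.im

namespace MarkedLinkage

variable (L : MarkedLinkage)

/-- The relative configuration space: all relative planar realizations. -/
def config : Set (L.V → ℂ) :=
  {φ | (∀ e, ‖φ (L.src e) - φ (L.tgt e)‖ ^ 2 = L.len e ^ 2) ∧ ∀ m, φ (L.mark m) = L.pos m}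

/-- Polynomials in the real coordinates of the images of the vertices. -/
abbrev Poly : Type := MvPolynomial (L.V × Fin 2) ℝ

/-- The equation `|φ(v) - φ(w)|² = ℓ[vw]²` of an edge. -/
def edgePoly (e : L.E) : L.Poly :=
  (MvPolynomial.X (L.src e, 0) - MvPolynomial.X (L.tgt e, 0)) ^ 2 +
    (MvPolynomial.X (L.src e, 1) - MvPolynomial.X (L.tgt e, 1)) ^ 2 -
      MvPolynomial.C (L.len e ^ 2)

/-- The equations `φ(w) = z` of a fixed vertex. -/
def markPoly (m : L.M) (j : Fin 2) : L.Poly :=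
  MvPolynomial.X (L.mark m, j) - MvPolynomial.C (planeCoord (L.pos m) j)

/-- The equations `φ(B) = (ℓ[BC]/ℓ[AC]) φ(A) + (ℓ[AB]/ℓ[AC]) φ(C)` of a degenerate triangle. -/
def trianglePoly (d : L.D) (j : Fin 2) : L.Poly :=
  MvPolynomial.X (L.triB d, j) -
    (MvPolynomial.C (L.len (L.sideBC d) / L.len (L.sideAC d)) * MvPolynomial.X (L.triA d, j) +
      MvPolynomial.C (L.len (L.sideAB d) / L.len (L.sideAC d)) * MvPolynomial.X (L.triC d, j))

/-- The equations of the configuration scheme. -/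
def equations : Set L.Poly :=
  {f | ∃ e, (∀ d, e ≠ L.sideAB d ∧ e ≠ L.sideBC d) ∧ f = L.edgePoly e} ∪
    ({f | ∃ m j, f = L.markPoly m j} ∪ {f | ∃ d j, f = L.trianglePoly d j})

/-- The ideal of the configuration scheme in the ambient affine space. -/
def ideal : Ideal L.Poly := Ideal.span L.equations

/-- The coordinate ring of the configuration scheme; it may have nilpotents. -/
abbrev CoordRing : Type := L.Poly ⧸ L.ideal

/-- The configuration scheme. -/
def scheme : Scheme := Spec (CommRingCat.of L.CoordRing)

/-- Evaluation of polynomials at a map from the vertices to the plane. -/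
def evalPoly (φ : L.V → ℂ) : L.Poly →ₐ[ℝ] ℝ :=
  MvPolynomial.aeval fun c => planeCoord (φ c.1) c.2

theorem eval_edgePoly (φ : L.V → ℂ) (e : L.E) :
    L.evalPoly φ (L.edgePoly e) = ‖φ (L.src e) - φ (L.tgt e)‖ ^ 2 - L.len e ^ 2 := by
  rw [← Complex.normSq_eq_norm_sq, Complex.normSq_apply]
  simp [evalPoly, edgePoly, planeCoord]
  ring

theorem eval_markPoly (φ : L.V → ℂ) (m : L.M) (j : Fin 2) :
    L.evalPoly φ (L.markPoly m j) = planeCoord (φ (L.mark m) - L.pos m) j := by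
  fin_cases j <;> simp [evalPoly, markPoly, planeCoord]

theorem eval_trianglePoly (φ : L.V → ℂ) (d : L.D) (j : Fin 2) :
    L.evalPoly φ (L.trianglePoly d j) =
      planeCoord (φ (L.triB d) -
        (((L.len (L.sideBC d) / L.len (L.sideAC d) : ℝ) : ℂ) * φ (L.triA d) +
          ((L.len (L.sideAB d) / L.len (L.sideAC d) : ℝ) : ℂ) * φ (L.triC d))) j := by
  fin_cases j <;> simp [evalPoly, trianglePoly, planeCoord, -Complex.ofReal_div]

theorem norm_of_joins {φ : L.V → ℂ} {e : L.E} {v w : L.V} (h : s(L.src e, L.tgt e) = s(v, w)) :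
    ‖φ (L.src e) - φ (L.tgt e)‖ = ‖φ v - φ w‖ := by
  rcases Sym2.eq_iff.1 h with ⟨h1, h2⟩ | ⟨h1, h2⟩
  · rw [h1, h2]
  · rw [h1, h2, norm_sub_rev]

theorem len_eq {φ : L.V → ℂ} (hφ : φ ∈ L.config) {e : L.E} {v w : L.V}
    (h : s(L.src e, L.tgt e) = s(v, w)) : ‖φ v - φ w‖ = L.len e := by
  rw [← L.norm_of_joins h]
  exact (pow_left_inj₀ (norm_nonneg _) (L.len_pos e).le two_ne_zero).1 (hφ.1 e)

theorem triangle_of_config {φ : L.V → ℂ} (hφ : φ ∈ L.config) (d : L.D) :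
    φ (L.triB d) = ((L.len (L.sideBC d) / L.len (L.sideAC d) : ℝ) : ℂ) * φ (L.triA d) +
      ((L.len (L.sideAB d) / L.len (L.sideAC d) : ℝ) : ℂ) * φ (L.triC d) := by
  have h1 := L.len_eq hφ (L.joins_AB d)
  have h2 := L.len_eq hφ (L.joins_BC d)
  have h3 := L.len_eq hφ (L.joins_AC d)
  have hd := L.degenerate d
  have p3 := L.len_pos (L.sideAC d)
  have hs : L.len (L.sideBC d) / L.len (L.sideAC d) =
      1 - L.len (L.sideAB d) / L.len (L.sideAC d) := by
    field_simp
    linarith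
  have key := eq_lineMap_of_dist_eq_mul_of_dist_eq_mul (x := φ (L.triA d)) (y := φ (L.triB d))
    (z := φ (L.triC d)) (r := L.len (L.sideAB d) / L.len (L.sideAC d))
    (by rw [dist_eq_norm, dist_eq_norm, h1, h3]; field_simp)
    (by rw [dist_eq_norm, dist_eq_norm, h2, h3, ← hs]; field_simp)
  rw [hs, key, AffineMap.lineMap_apply]
  simp only [vsub_eq_sub, vadd_eq_add, Complex.real_smul]
  push_cast
  ring

theorem planeCoord_eq_zero {z : ℂ} (h : ∀ j, planeCoord z j = 0) : z = 0 := by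
  have h0 := h 0
  have h1 := h 1
  simp [planeCoord] at h0 h1
  exact Complex.ext h0 h1

/-- The set of real points of the configuration scheme is the configuration space. -/
theorem mem_config_iff (φ : L.V → ℂ) : φ ∈ L.config ↔ ∀ f ∈ L.ideal, L.evalPoly φ f = 0 := by
  constructor
  · intro hφ f hf
    have hle : L.ideal ≤ RingHom.ker (L.evalPoly φ) := by
      refine Ideal.span_le.2 ?_
      rintro f (⟨e, -, rfl⟩ | ⟨m, j, rfl⟩ | ⟨d, j, rfl⟩)
      · change L.evalPoly φ _ = 0
        rw [L.eval_edgePoly, hφ.1 e, sub_self]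
      · change L.evalPoly φ _ = 0
        rw [L.eval_markPoly, hφ.2 m, sub_self]
        simp [planeCoord]
      · change L.evalPoly φ _ = 0
        rw [L.eval_trianglePoly, ← L.triangle_of_config hφ d, sub_self]
        simp [planeCoord]
    exact hle hf
  · intro h
    have h' : ∀ f ∈ L.equations, L.evalPoly φ f = 0 := fun f hf => h f (Ideal.subset_span hf)
    have htri : ∀ d, φ (L.triB d) =
        ((L.len (L.sideBC d) / L.len (L.sideAC d) : ℝ) : ℂ) * φ (L.triA d) +
          ((L.len (L.sideAB d) / L.len (L.sideAC d) : ℝ) : ℂ) * φ (L.triC d) := by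
      intro d
      refine sub_eq_zero.1 (planeCoord_eq_zero fun j => ?_)
      rw [← L.eval_trianglePoly]
      exact h' _ (Or.inr (Or.inr ⟨d, j, rfl⟩))
    refine ⟨?_, fun m => sub_eq_zero.1 (planeCoord_eq_zero fun j => ?_)⟩
    · by_contra! hbad
      obtain ⟨e, he, hmax⟩ := Set.exists_max_image
        {e | ‖φ (L.src e) - φ (L.tgt e)‖ ^ 2 ≠ L.len e ^ 2} L.len (Set.toFinite _) hbad
      have hac : ∀ d, L.len e < L.len (L.sideAC d) →
          ‖φ (L.triA d) - φ (L.triC d)‖ = L.len (L.sideAC d) := by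
        intro d hlt
        have := fun hb => (hmax (L.sideAC d) hb).not_gt hlt
        have this := not_not.1 this
        rw [← L.norm_of_joins (L.joins_AC d)]
        exact (pow_left_inj₀ (norm_nonneg _) (L.len_pos _).le two_ne_zero).1 this
      apply he
      by_cases hd : ∀ d, e ≠ L.sideAB d ∧ e ≠ L.sideBC d
      · have := h' _ (Or.inl ⟨e, hd, rfl⟩)
        rw [L.eval_edgePoly] at this
        linarith
      · push Not at hd
        obtain ⟨d, hd⟩ := hd
        have p1 := L.len_pos (L.sideAB d)
        have p2 := L.len_pos (L.sideBC d)
        have p3 := L.len_pos (L.sideAC d)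
        have hdeg := L.degenerate d
        have hs : L.len (L.sideBC d) / L.len (L.sideAC d) =
            1 - L.len (L.sideAB d) / L.len (L.sideAC d) := by
          field_simp
          linarith
        have hr : L.len (L.sideAB d) / L.len (L.sideAC d) =
            1 - L.len (L.sideBC d) / L.len (L.sideAC d) := by
          field_simp
          linarith
        by_cases h1 : e = L.sideAB d
        · rw [L.norm_of_joins (h1 ▸ L.joins_AB d), htri d, hs]
          have e1 : φ (L.triA d) - (((1 - L.len (L.sideAB d) / L.len (L.sideAC d) : ℝ) : ℂ) *
              φ (L.triA d) + ((L.len (L.sideAB d) / L.len (L.sideAC d) : ℝ) : ℂ) *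
                φ (L.triC d)) = ((L.len (L.sideAB d) / L.len (L.sideAC d) : ℝ) : ℂ) *
                (φ (L.triA d) - φ (L.triC d)) := by
            push_cast
            ring
          rw [e1, norm_mul, Complex.norm_real, hac d (by rw [h1]; linarith), Real.norm_eq_abs,
            abs_of_pos (div_pos p1 p3), div_mul_cancel₀ _ p3.ne', h1]
        · have h2 := hd h1
          rw [L.norm_of_joins (h2 ▸ L.joins_BC d), htri d, hr]
          have e1 : (((L.len (L.sideBC d) / L.len (L.sideAC d) : ℝ) : ℂ) *
              φ (L.triA d) + ((1 - L.len (L.sideBC d) / L.len (L.sideAC d) : ℝ) : ℂ) *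
                φ (L.triC d)) - φ (L.triC d) =
                ((L.len (L.sideBC d) / L.len (L.sideAC d) : ℝ) : ℂ) *
                (φ (L.triA d) - φ (L.triC d)) := by
            push_cast
            ring
          rw [e1, norm_mul, Complex.norm_real, hac d (by rw [h2]; linarith), Real.norm_eq_abs,
            abs_of_pos (div_pos p2 p3), div_mul_cancel₀ _ p3.ne', h2]
    · rw [← L.eval_markPoly]
      exact h' _ (Or.inr (Or.inl ⟨m, j, rfl⟩))

/-- The value of a function on the configuration scheme at a realization. -/
def evalAt (φ : L.config) : L.CoordRing →ₐ[ℝ] ℝ :=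
  Ideal.Quotient.liftₐ L.ideal (L.evalPoly φ.1) ((L.mem_config_iff φ.1).1 φ.2)

/-- The coordinate functions of a vertex. -/
def coordFun (v : L.V) (j : Fin 2) : L.CoordRing :=
  Ideal.Quotient.mk L.ideal (MvPolynomial.X (v, j))

/-! ### Real analytic germs and the analytic structure sheaf -/

end MarkedLinkage

/-- The ring of germs at `x` of real analytic functions on a real normed space. -/
def analyticGerms {X : Type*} [NormedAddCommGroup X] [NormedSpace ℝ X] (x : X) :
    Subring (Germ (𝓝 x) ℝ) where
  carrier := {γ | ∃ f : X → ℝ, AnalyticAt ℝ f x ∧ γ = (f : Germ (𝓝 x) ℝ)}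
  mul_mem' := by
    rintro _ _ ⟨f, hf, rfl⟩ ⟨g, hg, rfl⟩
    exact ⟨f * g, hf.mul hg, rfl⟩
  one_mem' := ⟨1, analyticAt_const, rfl⟩
  add_mem' := by
    rintro _ _ ⟨f, hf, rfl⟩ ⟨g, hg, rfl⟩
    exact ⟨f + g, hf.add hg, rfl⟩
  zero_mem' := ⟨0, analyticAt_const, rfl⟩
  neg_mem' := by
    rintro _ ⟨f, hf, rfl⟩
    exact ⟨-f, hf.neg, rfl⟩

/-- Pull-back of analytic germs along a continuous linear map. -/
def pullbackGerm {X Y : Type*} [NormedAddCommGroup X] [NormedSpace ℝ X] [NormedAddCommGroup Y]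
    [NormedSpace ℝ Y] (T : X →L[ℝ] Y) (x : X) (γ : analyticGerms (T x)) : analyticGerms x :=
  ⟨γ.1.compTendsto T T.continuous.continuousAt, by
    obtain ⟨_, f, hf, rfl⟩ := γ
    exact ⟨f ∘ T, hf.comp (T.analyticAt x), rfl⟩⟩

namespace MarkedLinkage

variable (L : MarkedLinkage)

/-- The stalk at `φ` of the ideal sheaf of the analytic space of the configuration scheme: the
ideal that the equations of the scheme generate in the ring of analytic germs. -/
def stalkIdeal (φ : L.V → ℂ) : Ideal (analyticGerms φ) :=
  Ideal.span {γ | ∃ f ∈ L.ideal, (γ : Germ (𝓝 φ) ℝ) = ((fun ψ => L.evalPoly ψ f : (L.V → ℂ) → ℝ) : Germ (𝓝 φ) ℝ)}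

/-- The stalk at `φ` of the analytic structure sheaf of the configuration scheme. -/
abbrev Stalk (φ : L.V → ℂ) : Type := analyticGerms φ ⧸ L.stalkIdeal φ

/-! ### Scheme-theoretic automorphisms -/

end MarkedLinkage

/-- The functions that are allowed in scheme-theoretic automorphisms: only the elements of the
coordinate ring, or also fractions whose denominators have no zero on the configuration space
(entire rational functions). -/
inductive FunctionClass
  | polynomial
  | entireRational

namespace MarkedLinkage

variable (L : MarkedLinkage)

/-- The denominators allowed in a class of functions. -/
def denominators : FunctionClass → Submonoid L.CoordRing
  | .polynomial => ⊥
  | .entireRational =>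
    { carrier := {a | ∀ φ, L.evalAt φ a ≠ 0}
      mul_mem' := fun ha hb φ => by rw [map_mul]; exact mul_ne_zero (ha φ) (hb φ)
      one_mem' := fun φ => by rw [map_one]; exact one_ne_zero }

theorem evalAt_denominator (c : FunctionClass) (φ : L.config) (s : L.denominators c) :
    IsUnit (L.evalAt φ s) := by
  obtain ⟨s, hs⟩ := s
  cases c with
  | polynomial =>
    obtain rfl : s = 1 := hs
    simp
  | entireRational => exact (hs φ).isUnit

/-- The ring of global functions of class `c` on the configuration scheme. -/
abbrev Functions (c : FunctionClass) : Type := Localization (L.denominators c)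

/-- The value at a realization of a function of class `c`. -/
def evalFun (c : FunctionClass) (φ : L.config) : L.Functions c →+* ℝ :=
  IsLocalization.lift (M := L.denominators c) (S := L.Functions c)
    (g := (L.evalAt φ : L.CoordRing →+* ℝ))
    (L.evalAt_denominator c φ)

/-- The coordinate functions of a vertex as functions of class `c`. -/
def coord (c : FunctionClass) (v : L.V) (j : Fin 2) : L.Functions c :=
  algebraMap L.CoordRing (L.Functions c) (L.coordFun v j)

end MarkedLinkage

/-! ## Fiber sums -/

namespace MarkedLinkage

variable (A B : MarkedLinkage) {τ : Type} (a : τ ↪ A.V) (b : τ ↪ B.V)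

/-- The vertex `a t` of the first linkage is glued to the vertex `b t` of the second one. -/
def GlueRel (x y : A.V ⊕ B.V) : Prop := ∃ t, x = Sum.inl (a t) ∧ y = Sum.inr (b t)

/-- The vertices of the fiber sum. -/
abbrev GlueV : Type := Quot (GlueRel A B a b)

/-- The vertices of the first linkage in the fiber sum. -/
def glueInl (v : A.V) : GlueV A B a b := Quot.mk _ (Sum.inl v)

/-- The vertices of the second linkage in the fiber sum. -/
def glueInr (v : B.V) : GlueV A B a b := Quot.mk _ (Sum.inr v)

theorem glue_eq (t : τ) : glueInl A B a b (a t) = glueInr A B a b (b t) :=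
  Quot.sound ⟨t, rfl, rfl⟩

theorem glueInl_injective : Function.Injective (glueInl A B a b) := by
  classical
  let r : A.V ⊕ B.V → A.V ⊕ B.V := Sum.elim Sum.inl fun v =>
    if h : ∃ t, b t = v then Sum.inl (a h.choose) else Sum.inr v
  have hr : ∀ x y, GlueRel A B a b x y → r x = r y := by
    rintro _ _ ⟨t, rfl, rfl⟩
    have h : ∃ s, b s = b t := ⟨t, rfl⟩
    have : h.choose = t := b.injective h.choose_spec
    simp [r]
  intro v w h
  exact Sum.inl_injective (congrArg (Quot.lift r hr) h)

theorem glueInr_injective : Function.Injective (glueInr A B a b) := by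
  classical
  let r : A.V ⊕ B.V → A.V ⊕ B.V := Sum.elim
    (fun v => if h : ∃ t, a t = v then Sum.inr (b h.choose) else Sum.inl v) Sum.inr
  have hr : ∀ x y, GlueRel A B a b x y → r x = r y := by
    rintro _ _ ⟨t, rfl, rfl⟩
    have h : ∃ s, a s = a t := ⟨t, rfl⟩
    have : h.choose = t := a.injective h.choose_spec
    simp [r]
  intro v w h
  exact Sum.inr_injective (congrArg (Quot.lift r hr) h)

theorem exists_of_glue_eq {v : A.V} {w : B.V} (h : glueInl A B a b v = glueInr A B a b w) :
    ∃ t, a t = v ∧ b t = w := by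
  classical
  by_contra hno
  let r : A.V ⊕ B.V → Prop := Sum.elim (fun x => ∃ t, a t = x ∧ b t = w) (fun y => y = w)
  have hr : ∀ x y, GlueRel A B a b x y → r x = r y := by
    rintro _ _ ⟨t, rfl, rfl⟩
    refine propext ⟨?_, fun h => ⟨t, rfl, h⟩⟩
    rintro ⟨s, hs, hw⟩
    obtain rfl := a.injective hs
    exact hw
  have := congrArg (Quot.lift r hr) h
  exact hno (this.mpr rfl)

/-- The fiber sum of two linkages: the disjoint union with `a t` and `b t` identified for all
`t`, with the markings of both. -/
def fiberSum : MarkedLinkage where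
  V := GlueV A B a b
  E := A.E ⊕ B.E
  M := A.M ⊕ B.M
  D := A.D ⊕ B.D
  fintypeV := Fintype.ofFinite _
  src := Sum.elim (fun e => glueInl A B a b (A.src e)) (fun e => glueInr A B a b (B.src e))
  tgt := Sum.elim (fun e => glueInl A B a b (A.tgt e)) (fun e => glueInr A B a b (B.tgt e))
  src_ne_tgt := by
    rintro (e | e) h
    · exact A.src_ne_tgt e (glueInl_injective A B a b h)
    · exact B.src_ne_tgt e (glueInr_injective A B a b h)
  len := Sum.elim A.len B.len
  len_pos := by
    rintro (e | e)
    · exact A.len_pos e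
    · exact B.len_pos e
  mark := Sum.elim (fun m => glueInl A B a b (A.mark m)) (fun m => glueInr A B a b (B.mark m))
  pos := Sum.elim A.pos B.pos
  triA := Sum.elim (fun d => glueInl A B a b (A.triA d)) (fun d => glueInr A B a b (B.triA d))
  triB := Sum.elim (fun d => glueInl A B a b (A.triB d)) (fun d => glueInr A B a b (B.triB d))
  triC := Sum.elim (fun d => glueInl A B a b (A.triC d)) (fun d => glueInr A B a b (B.triC d))
  sideAB := Sum.map A.sideAB B.sideAB
  sideBC := Sum.map A.sideBC B.sideBC
  sideAC := Sum.map A.sideAC B.sideAC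
  joins_AB := by
    rintro (d | d)
    · exact congrArg (Sym2.map (glueInl A B a b)) (A.joins_AB d)
    · exact congrArg (Sym2.map (glueInr A B a b)) (B.joins_AB d)
  joins_BC := by
    rintro (d | d)
    · exact congrArg (Sym2.map (glueInl A B a b)) (A.joins_BC d)
    · exact congrArg (Sym2.map (glueInr A B a b)) (B.joins_BC d)
  joins_AC := by
    rintro (d | d)
    · exact congrArg (Sym2.map (glueInl A B a b)) (A.joins_AC d)
    · exact congrArg (Sym2.map (glueInr A B a b)) (B.joins_AC d)
  degenerate := by
    rintro (d | d)
    · exact A.degenerate d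
    · exact B.degenerate d

/-- Restriction of realizations of the fiber sum to the first linkage. -/
def restrictLeft (φ : (fiberSum A B a b).config) : A.config :=
  ⟨fun v => φ.1 (glueInl A B a b v), fun e => φ.2.1 (Sum.inl e), fun m => φ.2.2 (Sum.inl m)⟩

/-- Restriction of realizations of the fiber sum to the second linkage. -/
def restrictRight (φ : (fiberSum A B a b).config) : B.config :=
  ⟨fun v => φ.1 (glueInr A B a b v), fun e => φ.2.1 (Sum.inr e), fun m => φ.2.2 (Sum.inr m)⟩

/-- The inclusion of coordinates dual to the restriction to the first linkage. -/
def polyLeft : A.Poly →ₐ[ℝ] (fiberSum A B a b).Poly :=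
  MvPolynomial.rename (Prod.map (glueInl A B a b) id)

/-- The inclusion of coordinates dual to the restriction to the second linkage. -/
def polyRight : B.Poly →ₐ[ℝ] (fiberSum A B a b).Poly :=
  MvPolynomial.rename (Prod.map (glueInr A B a b) id)

theorem polyLeft_edge (e : A.E) :
    polyLeft A B a b (A.edgePoly e) = (fiberSum A B a b).edgePoly (Sum.inl e) := by
  simp only [polyLeft, edgePoly, map_sub, map_add, map_pow, MvPolynomial.rename_X,
    MvPolynomial.rename_C]
  rfl

theorem polyLeft_mark (m : A.M) (j : Fin 2) :
    polyLeft A B a b (A.markPoly m j) = (fiberSum A B a b).markPoly (Sum.inl m) j := by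
  simp only [polyLeft, markPoly, map_sub, MvPolynomial.rename_X, MvPolynomial.rename_C]
  rfl

theorem polyLeft_triangle (d : A.D) (j : Fin 2) :
    polyLeft A B a b (A.trianglePoly d j) = (fiberSum A B a b).trianglePoly (Sum.inl d) j := by
  simp only [polyLeft, trianglePoly, map_sub, map_add, map_mul, MvPolynomial.rename_X,
    MvPolynomial.rename_C]
  rfl

theorem ideal_le_left : A.ideal ≤ (fiberSum A B a b).ideal.comap (polyLeft A B a b) := by
  refine Ideal.span_le.2 ?_
  rintro f (⟨e, he, rfl⟩ | ⟨m, j, rfl⟩ | ⟨d, j, rfl⟩) <;> refine Ideal.subset_span ?_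
  · refine Or.inl ⟨Sum.inl e, ?_, ?_⟩
    · rintro (d | d)
      · exact ⟨fun h => (he d).1 (Sum.inl_injective h), fun h => (he d).2 (Sum.inl_injective h)⟩
      · exact ⟨Sum.inl_ne_inr, Sum.inl_ne_inr⟩
    · exact polyLeft_edge A B a b e
  · refine Or.inr (Or.inl ⟨Sum.inl m, j, ?_⟩)
    exact polyLeft_mark A B a b m j
  · refine Or.inr (Or.inr ⟨Sum.inl d, j, ?_⟩)
    exact polyLeft_triangle A B a b d j

theorem polyRight_edge (e : B.E) :
    polyRight A B a b (B.edgePoly e) = (fiberSum A B a b).edgePoly (Sum.inr e) := by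
  simp only [polyRight, edgePoly, map_sub, map_add, map_pow, MvPolynomial.rename_X,
    MvPolynomial.rename_C]
  rfl

theorem polyRight_mark (m : B.M) (j : Fin 2) :
    polyRight A B a b (B.markPoly m j) = (fiberSum A B a b).markPoly (Sum.inr m) j := by
  simp only [polyRight, markPoly, map_sub, MvPolynomial.rename_X, MvPolynomial.rename_C]
  rfl

theorem polyRight_triangle (d : B.D) (j : Fin 2) :
    polyRight A B a b (B.trianglePoly d j) = (fiberSum A B a b).trianglePoly (Sum.inr d) j := by
  simp only [polyRight, trianglePoly, map_sub, map_add, map_mul, MvPolynomial.rename_X,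
    MvPolynomial.rename_C]
  rfl

theorem ideal_le_right : B.ideal ≤ (fiberSum A B a b).ideal.comap (polyRight A B a b) := by
  refine Ideal.span_le.2 ?_
  rintro f (⟨e, he, rfl⟩ | ⟨m, j, rfl⟩ | ⟨d, j, rfl⟩) <;> refine Ideal.subset_span ?_
  · refine Or.inl ⟨Sum.inr e, ?_, ?_⟩
    · rintro (d | d)
      · exact ⟨Sum.inr_ne_inl, Sum.inr_ne_inl⟩
      · exact ⟨fun h => (he d).1 (Sum.inr_injective h), fun h => (he d).2 (Sum.inr_injective h)⟩
    · exact polyRight_edge A B a b e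
  · refine Or.inr (Or.inl ⟨Sum.inr m, j, ?_⟩)
    exact polyRight_mark A B a b m j
  · refine Or.inr (Or.inr ⟨Sum.inr d, j, ?_⟩)
    exact polyRight_triangle A B a b d j

/-- The restriction morphism from the configuration scheme of the fiber sum to the one of the
first linkage. -/
def schemeLeft : (fiberSum A B a b).scheme ⟶ A.scheme :=
  Spec.map (CommRingCat.ofHom (Ideal.quotientMap (fiberSum A B a b).ideal
    (polyLeft A B a b : A.Poly →+* (fiberSum A B a b).Poly) (ideal_le_left A B a b)))

/-- The restriction morphism from the configuration scheme of the fiber sum to the one of the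
second linkage. -/
def schemeRight : (fiberSum A B a b).scheme ⟶ B.scheme :=
  Spec.map (CommRingCat.ofHom (Ideal.quotientMap (fiberSum A B a b).ideal
    (polyRight A B a b : B.Poly →+* (fiberSum A B a b).Poly) (ideal_le_right A B a b)))

variable {A} in
/-- The morphism from the configuration scheme to the affine space `(𝔸²)^τ` which evaluates
realizations at the vertices `a t`. -/
def schemeEval (a : τ → A.V) :
    A.scheme ⟶ Spec (CommRingCat.of (MvPolynomial (τ × Fin 2) ℝ)) :=
  Spec.map (CommRingCat.ofHom
    (MvPolynomial.aeval (R := ℝ) (fun c : τ × Fin 2 => A.coordFun (a c.1) c.2)).toRingHom)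

end MarkedLinkage

/-! ## Linkages with inputs and outputs -/

/-- A marked linkage with distinguished input vertices, indexed by `ι`, and distinguished output
vertices, indexed by `κ`. A vertex may be both an input and an output. -/
structure IOLinkage (ι κ : Type) extends MarkedLinkage where
  input : ι ↪ V
  output : κ ↪ V

namespace IOLinkage

variable {ι κ τ ρ : Type}

/-- The composition of linkages: the outputs of `B` are glued to the inputs of `A` indexed by
`τ`. The inputs are those of `B` and the remaining ones of `A`, the outputs are those of `A`. -/
def comp (A : IOLinkage (τ ⊕ ρ) κ) (B : IOLinkage ι τ) : IOLinkage (ι ⊕ ρ) κ where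
  toMarkedLinkage := MarkedLinkage.fiberSum A.toMarkedLinkage B.toMarkedLinkage
    (Function.Embedding.inl.trans A.input) B.output
  input :=
    { toFun := Sum.elim (fun i => MarkedLinkage.glueInr _ _ _ _ (B.input i))
        (fun r => MarkedLinkage.glueInl _ _ _ _ (A.input (Sum.inr r)))
      inj' := by
        rintro (i | r) (i' | r') h
        · exact congrArg _ (B.input.injective (MarkedLinkage.glueInr_injective _ _ _ _ h))
        · obtain ⟨t, ht, -⟩ := MarkedLinkage.exists_of_glue_eq _ _ _ _ h.symm
          exact absurd (A.input.injective ht) Sum.inl_ne_inr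
        · obtain ⟨t, ht, -⟩ := MarkedLinkage.exists_of_glue_eq _ _ _ _ h
          exact absurd (A.input.injective ht) Sum.inl_ne_inr
        · exact congrArg _ (Sum.inr_injective (A.input.injective
            (MarkedLinkage.glueInl_injective _ _ _ _ h))) }
  output :=
    { toFun := fun k => MarkedLinkage.glueInl _ _ _ _ (A.output k)
      inj' := fun _ _ h => A.output.injective (MarkedLinkage.glueInl_injective _ _ _ _ h) }

/-- Restriction of realizations of the composition to `A`. -/
def resA (A : IOLinkage (τ ⊕ ρ) κ) (B : IOLinkage ι τ) (φ : (A.comp B).config) : A.config :=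
  MarkedLinkage.restrictLeft _ _ _ _ φ

/-- Restriction of realizations of the composition to `B`. -/
def resB (A : IOLinkage (τ ⊕ ρ) κ) (B : IOLinkage ι τ) (φ : (A.comp B).config) : B.config :=
  MarkedLinkage.restrictRight _ _ _ _ φ

section Functional

variable (L : IOLinkage ι κ)

/-- The output map. -/
def outputMap (φ : L.config) : κ → ℂ := fun k => φ.1 (L.output k)

/-- The walls: the fixed points of the nontrivial elements of a group of symmetries. -/
def wall (G : Subgroup (Equiv.Perm L.config)) : Set L.config :=
  {φ | ∃ σ ∈ G, σ ≠ 1 ∧ σ φ = φ}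

/-- The bijection `σ` of the configuration space is induced by an automorphism of the configuration
scheme, with functions of class `c`, which commutes with the input and the output morphism. -/
def IsSchemeAut (c : FunctionClass) (σ : Equiv.Perm L.config) : Prop :=
  ∃ e : L.Functions c ≃ₐ[ℝ] L.Functions c,
    (∀ φ u, L.evalFun c φ (e u) = L.evalFun c (σ φ) u) ∧
    (∀ i j, e (L.coord c (L.input i) j) = L.coord c (L.input i) j) ∧
    ∀ k j, e (L.coord c (L.output k) j) = L.coord c (L.output k) j

variable (𝕜 : Type) [RCLike 𝕜] [Fintype ι]

/-- The input map, with values in `𝕜^ι`. Here `𝕜 = ℂ` is the whole plane and `𝕜 = ℝ` is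
identified with the real axis; for `𝕜 = ℝ` the imaginary parts are dropped, and functional
linkages are required to have inputs on the real axis. -/
def inputMap : (L.V → ℂ) →L[ℝ] (ι → 𝕜) :=
  ContinuousLinearMap.pi fun i =>
    (RCLike.map ℂ 𝕜).comp (ContinuousLinearMap.proj (R := ℝ) (L.input i))

/-- The domain: the set of all positions of the inputs. -/
def dom : Set (ι → 𝕜) := L.inputMap 𝕜 '' L.config

/-- The input map as a map from the configuration space onto the domain. -/
def inputOnto (φ : L.config) : L.dom 𝕜 := ⟨L.inputMap 𝕜 φ.1, φ.1, φ.2, rfl⟩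

/-- A realization is regular if the input morphism is there a local analytic isomorphism, in the
scheme-theoretic sense, onto `𝕜^ι`: it induces an isomorphism of the stalks of the analytic
structure sheaves. -/
def IsRegularAt (φ : L.V → ℂ) : Prop :=
  Function.Bijective fun γ : analyticGerms (L.inputMap 𝕜 φ) =>
    (Ideal.Quotient.mk (L.stalkIdeal φ) (pullbackGerm (L.inputMap 𝕜) φ γ) : L.Stalk φ)

/-- The critical set: the irregular points of the input morphism. -/
def crit : Set L.config := {φ | ¬ L.IsRegularAt 𝕜 φ.1}

/-- The image `Dom*` of the regular realizations under the input map. -/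
def domStar : Set (ι → 𝕜) := {x | ∃ φ : L.config, φ ∉ L.crit 𝕜 ∧ L.inputMap 𝕜 φ.1 = x}

/-- The projections of the walls to the domain. -/
def wallInDom (G : Subgroup (Equiv.Perm L.config)) : Set (ι → 𝕜) :=
  (fun φ : L.config => L.inputMap 𝕜 φ.1) '' L.wall G

/-- The input map is the quotient map of the configuration space onto a domain in `𝕜^ι` for a
finite group `G` of scheme-theoretic automorphisms, and the linkage computes `F` on that domain. -/
structure ComputesWithGroup (c : FunctionClass) (G : Subgroup (Equiv.Perm L.config))
    (F : (ι → 𝕜) → κ → ℂ) : Prop where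
  /-- The inputs lie in `𝕜`. -/
  input_mem : ∀ (φ : L.config) (i : ι), RCLike.map 𝕜 ℂ (L.inputMap 𝕜 φ.1 i) = φ.1 (L.input i)
  /-- The image of the input map is a domain, i.e. has nonempty interior. -/
  interior_dom : (interior (L.dom 𝕜)).Nonempty
  finite_group : Finite G
  scheme_aut : ∀ σ ∈ G, L.IsSchemeAut c σ
  /-- The fibers of the input map are the orbits of the group. -/
  fiber_iff : ∀ φ ψ : L.config, L.inputMap 𝕜 φ.1 = L.inputMap 𝕜 ψ.1 ↔ ∃ σ ∈ G, σ φ = ψ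
  /-- The domain has the quotient topology. -/
  isQuotientMap : IsQuotientMap (L.inputOnto 𝕜)
  /-- The output map factors through the input map and induces `F`. -/
  output_eq : ∀ φ : L.config, L.outputMap φ = F (L.inputMap 𝕜 φ.1)

/-- The linkage is `𝕜`-functional for `F` with the symmetry group `G`: the input map is a regular
branched covering of a domain with the group `G`, i.e. the quotient map for a finite group `G` of
scheme-theoretic automorphisms whose branch set, the walls, is nowhere dense (off the walls `G`
acts freely, so that there the input map is a regular covering with the group `G`), and the output
map induces `F`. The linkage then defines the germ of `F` at each point of `Dom*`. -/
structure IsFunctional (c : FunctionClass) (G : Subgroup (Equiv.Perm L.config))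
    (F : (ι → 𝕜) → κ → ℂ) : Prop extends L.ComputesWithGroup 𝕜 c G F where
  wall_nowhereDense : IsNowhereDense (L.wall G)

end Functional

/-- The fiber product `Dom(A) ×_{π_T = g} Dom(B)`. -/
def domProduct (𝕜 : Type) [RCLike 𝕜] [Fintype ι] [Fintype τ] [Fintype ρ]
    (A : IOLinkage (τ ⊕ ρ) κ) (B : IOLinkage ι τ) (g : (ι → 𝕜) → τ → ℂ) :
    Set ((τ ⊕ ρ → ℂ) × (ι → 𝕜)) :=
  {z | z.1 ∈ A.dom ℂ ∧ z.2 ∈ B.dom 𝕜 ∧ (fun t => z.1 (Sum.inl t)) = g z.2}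

end IOLinkage

/-! ## Semi-algebraic sets and isomorphisms -/

/-- The polynomial functions on a real vector space. -/
def realPolynomials (X : Type*) [AddCommGroup X] [Module ℝ X] : Subalgebra ℝ (X → ℝ) :=
  Algebra.adjoin ℝ {f | ∃ l : X →ₗ[ℝ] ℝ, f = l}

/-- The semi-algebraic sets: the Boolean algebra generated by the sets `{x | f x > 0}` for
polynomial functions `f`. -/
inductive IsSemialgebraic {X : Type*} [AddCommGroup X] [Module ℝ X] : Set X → Prop
  | pos (f : X → ℝ) (hf : f ∈ realPolynomials X) : IsSemialgebraic {x | 0 < f x}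
  | compl (S : Set X) (hS : IsSemialgebraic S) : IsSemialgebraic Sᶜ
  | union (S T : Set X) (hS : IsSemialgebraic S) (hT : IsSemialgebraic T) :
      IsSemialgebraic (S ∪ T)

/-- A homeomorphism between subsets of two real vector spaces is a semi-algebraic isomorphism if
its graph is semi-algebraic relative to their product. -/
def IsSemialgebraicIso {X Y : Type*} [AddCommGroup X] [Module ℝ X] [TopologicalSpace X]
    [AddCommGroup Y] [Module ℝ Y] [TopologicalSpace Y] {S : Set X} {T : Set Y} (θ : S ≃ₜ T) :
    Prop :=
  ∃ Γ : Set (X × Y), IsSemialgebraic Γ ∧ ∀ (x : S) (y : T), θ x = y ↔ ((x : X), (y : Y)) ∈ Γ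

end

noncomputable section

/-! ## The coordinate ring of a fiber sum is a pushout -/

namespace MarkedLinkage

section CoordRing

variable {L : MarkedLinkage} {R : Type*} [CommRing R] [Algebra ℝ R]

/-! A realization of the composition is a pair of realizations of `A` and `B` that agree at the
glued vertices. This holds at every level: the coordinate ring is a pushout
(`exists_coordRing_lift`), compatible pairs of realizations glue (`exists_comp_config`), and the
topology is the one induced from the product (`isInducing_res`). Because the outputs of `B` are `g`
of its inputs, compatibility of a pair depends only on its inputs
(`exists_comp_config_of_inputMap`). Hence the input map of the composition is the base change of the
product of the two input maps to the fiber product of the domains, followed by a homeomorphism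
(`domHomeomorph`) that drops the glued coordinates, which `g` restores.

The covering properties follow from this description. A quotient map by a finite group is open, and
openness survives the base change. Symmetries of `A` fix its inputs and symmetries of `B` fix its
outputs, so every pair of symmetries acts on compatible pairs, and the orbits of these actions are
the fibers. The algebra automorphisms glue for the same reason (`exists_functions_glueEquiv`). A
nontrivial pair has a nontrivial component, which bounds the walls from above. Equality of the walls
and the product structure of the group need the action of pairs to be faithful, and one point off
both walls suffices for that. Density of the good part of the fiber product pulls back along the
open input map and makes the walls nowhere dense.

For the critical set, an isomorphism of stalks is rewritten as the existence of an analytic section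
`s` of the input map, with values in the configuration space, such that every `ψ` is congruent to
`s` of its inputs modulo the stalk of the ideal (`isRegularAt_iff_exists_section`). Such sections
can be composed, since congruences modulo an ideal of germs survive analytic substitution
(`GermCongr.analyticAt_comp`). That rests on Hadamard's lemma, `f u - f w = G (u, w) (u - w)` with
`G` analytic, which is obtained by telescoping the power series term by term. -/

theorem CoordRing.algHom_ext {f g : L.CoordRing →ₐ[ℝ] R}
    (h : ∀ v j, f (L.coordFun v j) = g (L.coordFun v j)) : f = g := by
  refine Ideal.Quotient.algHom_ext _ (MvPolynomial.algHom_ext fun c => ?_)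
  exact h c.1 c.2

end CoordRing

variable (A B : MarkedLinkage) {τ : Type} (a : τ ↪ A.V) (b : τ ↪ B.V)

theorem glueV_cases {p : GlueV A B a b → Prop} (hl : ∀ v, p (glueInl A B a b v))
    (hr : ∀ v, p (glueInr A B a b v)) (v : GlueV A B a b) : p v := by
  rcases v with ⟨v | v⟩
  exacts [hl v, hr v]

/-- The homomorphism of coordinate rings dual to the restriction to the first linkage. -/
def coordLeft : A.CoordRing →ₐ[ℝ] (fiberSum A B a b).CoordRing :=
  Ideal.quotientMapₐ (fiberSum A B a b).ideal (polyLeft A B a b) (ideal_le_left A B a b)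

/-- The homomorphism of coordinate rings dual to the restriction to the second linkage. -/
def coordRight : B.CoordRing →ₐ[ℝ] (fiberSum A B a b).CoordRing :=
  Ideal.quotientMapₐ (fiberSum A B a b).ideal (polyRight A B a b) (ideal_le_right A B a b)

theorem coordLeft_coordFun (v : A.V) (j : Fin 2) :
    coordLeft A B a b (A.coordFun v j) =
      (fiberSum A B a b).coordFun (glueInl A B a b v) j := by
  change Ideal.Quotient.mk _ (polyLeft A B a b (MvPolynomial.X (v, j))) = _
  rw [polyLeft, MvPolynomial.rename_X]
  rfl

theorem coordRight_coordFun (v : B.V) (j : Fin 2) :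
    coordRight A B a b (B.coordFun v j) =
      (fiberSum A B a b).coordFun (glueInr A B a b v) j := by
  change Ideal.Quotient.mk _ (polyRight A B a b (MvPolynomial.X (v, j))) = _
  rw [polyRight, MvPolynomial.rename_X]
  rfl

variable {A B a b} {R : Type*} [CommRing R] [Algebra ℝ R]

/-- The coordinates of a compatible pair of homomorphisms on a fiber sum. -/
def glueCoord (f : A.V → Fin 2 → R) (h : B.V → Fin 2 → R) (w : ∀ t j, f (a t) j = h (b t) j)
    (c : GlueV A B a b × Fin 2) : R :=
  Quot.lift (Sum.elim (fun v => f v c.2) fun v => h v c.2)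
    (by rintro _ _ ⟨t, rfl, rfl⟩; exact w t c.2) c.1

/-- Every equation of the fiber sum comes from one of the two linkages. The triangles of one linkage
replace no edge equations of the other, so an edge equation kept in the sum was already kept in its
own linkage. -/
theorem aeval_equations_of_glue (f : A.CoordRing →ₐ[ℝ] R) (h : B.CoordRing →ₐ[ℝ] R)
    (k : (fiberSum A B a b).Poly →ₐ[ℝ] R)
    (hf : ∀ p, k (polyLeft A B a b p) = f (Ideal.Quotient.mk _ p))
    (hh : ∀ p, k (polyRight A B a b p) = h (Ideal.Quotient.mk _ p))
    (p : (fiberSum A B a b).Poly) (hp : p ∈ (fiberSum A B a b).ideal) : k p = 0 := by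
  have hle : (fiberSum A B a b).ideal ≤ RingHom.ker k := by
    refine Ideal.span_le.2 ?_
    have hA : ∀ p ∈ A.equations, k (polyLeft A B a b p) = 0 := fun p hp => by
      rw [hf, (Ideal.Quotient.eq_zero_iff_mem (I := A.ideal)).2 (Ideal.subset_span hp), map_zero]
    have hB : ∀ p ∈ B.equations, k (polyRight A B a b p) = 0 := fun p hp => by
      rw [hh, (Ideal.Quotient.eq_zero_iff_mem (I := B.ideal)).2 (Ideal.subset_span hp), map_zero]
    rintro _ (⟨e | e, he, rfl⟩ | ⟨m | m, j, rfl⟩ | ⟨d | d, j, rfl⟩)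
    · rw [← polyLeft_edge]
      exact hA _ (Or.inl ⟨e, fun d => ⟨fun h => (he (Sum.inl d)).1 (congrArg Sum.inl h),
        fun h => (he (Sum.inl d)).2 (congrArg Sum.inl h)⟩, rfl⟩)
    · rw [← polyRight_edge]
      exact hB _ (Or.inl ⟨e, fun d => ⟨fun h => (he (Sum.inr d)).1 (congrArg Sum.inr h),
        fun h => (he (Sum.inr d)).2 (congrArg Sum.inr h)⟩, rfl⟩)
    · rw [← polyLeft_mark]
      exact hA _ (Or.inr (Or.inl ⟨m, j, rfl⟩))
    · rw [← polyRight_mark]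
      exact hB _ (Or.inr (Or.inl ⟨m, j, rfl⟩))
    · rw [← polyLeft_triangle]
      exact hA _ (Or.inr (Or.inr ⟨d, j, rfl⟩))
    · rw [← polyRight_triangle]
      exact hB _ (Or.inr (Or.inr ⟨d, j, rfl⟩))
  exact hle hp

/-- The universal property of the coordinate ring of a fiber sum. -/
theorem exists_coordRing_lift (f : A.CoordRing →ₐ[ℝ] R) (h : B.CoordRing →ₐ[ℝ] R)
    (w : ∀ t j, f (A.coordFun (a t) j) = h (B.coordFun (b t) j)) :
    ∃ k : (fiberSum A B a b).CoordRing →ₐ[ℝ] R,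
      k.comp (coordLeft A B a b) = f ∧ k.comp (coordRight A B a b) = h := by
  let k : (fiberSum A B a b).Poly →ₐ[ℝ] R := MvPolynomial.aeval
    (glueCoord (fun v j => f (A.coordFun v j)) (fun v j => h (B.coordFun v j)) w)
  have hf : k.comp (polyLeft A B a b) = f.comp (Ideal.Quotient.mkₐ ℝ A.ideal) := by
    refine MvPolynomial.algHom_ext fun c => ?_
    change k (polyLeft A B a b (MvPolynomial.X c)) = _
    rw [polyLeft, MvPolynomial.rename_X]
    exact MvPolynomial.aeval_X _ _
  have hh : k.comp (polyRight A B a b) = h.comp (Ideal.Quotient.mkₐ ℝ B.ideal) := by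
    refine MvPolynomial.algHom_ext fun c => ?_
    change k (polyRight A B a b (MvPolynomial.X c)) = _
    rw [polyRight, MvPolynomial.rename_X]
    exact MvPolynomial.aeval_X _ _
  exact ⟨Ideal.Quotient.liftₐ _ k (aeval_equations_of_glue f h k
    (fun p => DFunLike.congr_fun hf p) fun p => DFunLike.congr_fun hh p),
    Ideal.Quotient.algHom_ext _ hf, Ideal.Quotient.algHom_ext _ hh⟩

/-- Stated for ring homomorphisms because the pushout is tested in commutative rings; agreement on
real constants is inherited from the first linkage. -/
theorem coordRing_ringHom_ext {S : Type*} [CommRing S]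
    {f g : (fiberSum A B a b).CoordRing →+* S}
    (hl : ∀ x, f (coordLeft A B a b x) = g (coordLeft A B a b x))
    (hr : ∀ x, f (coordRight A B a b x) = g (coordRight A B a b x)) : f = g := by
  refine Ideal.Quotient.ringHom_ext (MvPolynomial.ringHom_ext (fun r => ?_) ?_)
  · have := hl (algebraMap ℝ _ r)
    rwa [AlgHom.commutes] at this
  · rintro ⟨v, j⟩
    induction v using glueV_cases with
    | hl v =>
      have := hl (A.coordFun v j)
      rwa [coordLeft_coordFun] at this
    | hr v =>
      have := hr (B.coordFun v j)
      rwa [coordRight_coordFun] at this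

-- `Spec` turns pushouts of rings into pullbacks of schemes, and the pushout property is the
-- universal property of the coordinate ring.
variable (A B a b) in
theorem isPullback_fiberSum :
    IsPullback (schemeLeft A B a b) (schemeRight A B a b) (schemeEval fun t => a t)
      (schemeEval fun t => b t) := by
  let α : MvPolynomial (τ × Fin 2) ℝ →ₐ[ℝ] A.CoordRing :=
    MvPolynomial.aeval fun c => A.coordFun (a c.1) c.2
  let β : MvPolynomial (τ × Fin 2) ℝ →ₐ[ℝ] B.CoordRing :=
    MvPolynomial.aeval fun c => B.coordFun (b c.1) c.2
  have comm : (coordLeft A B a b).comp α = (coordRight A B a b).comp β := by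
    refine MvPolynomial.algHom_ext fun c => ?_
    simp only [AlgHom.comp_apply, MvPolynomial.aeval_X, coordLeft_coordFun, coordRight_coordFun,
      glue_eq, α, β]
  refine isPullback_SpecMap_of_isPushout (CommRingCat.ofHom α.toRingHom)
    (CommRingCat.ofHom β.toRingHom) (CommRingCat.ofHom (coordLeft A B a b).toRingHom)
    (CommRingCat.ofHom (coordRight A B a b).toRingHom) (IsPushout.of_isColimit'
    ⟨CommRingCat.hom_ext (RingHom.ext fun p => DFunLike.congr_fun comm p)⟩
    (Limits.PushoutCocone.isColimitAux' _ fun s => Classical.indefiniteDescription _ ?_))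
  have hs : ∀ p, s.inl.hom (α p) = s.inr.hom (β p) := fun p =>
    RingHom.congr_fun (congrArg CommRingCat.Hom.hom s.condition) p
  -- The test ring carries no real structure of its own, so it takes one through `A`. The cocone
  -- condition on constants then makes the map from `B` linear over `ℝ` as well.
  let _ : Algebra ℝ s.pt := (s.inl.hom.comp (algebraMap ℝ A.CoordRing)).toAlgebra
  let f : A.CoordRing →ₐ[ℝ] s.pt := { s.inl.hom with commutes' := fun _ => rfl }
  let h : B.CoordRing →ₐ[ℝ] s.pt := { s.inr.hom with
    commutes' := fun r => by
      have := hs (algebraMap ℝ _ r)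
      rw [AlgHom.commutes, AlgHom.commutes] at this
      exact this.symm }
  obtain ⟨k, hkf, hkh⟩ := exists_coordRing_lift (a := a) (b := b) f h fun t j => by
    have := hs (MvPolynomial.X (t, j))
    simp only [α, β, MvPolynomial.aeval_X] at this
    exact this
  refine ⟨CommRingCat.ofHom k.toRingHom,
    CommRingCat.hom_ext (RingHom.ext fun x => DFunLike.congr_fun hkf x),
    CommRingCat.hom_ext (RingHom.ext fun x => DFunLike.congr_fun hkh x), fun {m} hml hmr => ?_⟩
  refine CommRingCat.hom_ext (coordRing_ringHom_ext (fun x => ?_) fun x => ?_)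
  · exact (RingHom.congr_fun (congrArg CommRingCat.Hom.hom hml) x).trans
      (DFunLike.congr_fun hkf x).symm
  · exact (RingHom.congr_fun (congrArg CommRingCat.Hom.hom hmr) x).trans
      (DFunLike.congr_fun hkh x).symm

end MarkedLinkage

/-! ## Functions of a given class on configuration schemes -/

namespace MarkedLinkage

section Functions

variable {L L' : MarkedLinkage} {c : FunctionClass}

theorem evalAt_coordFun (φ : L.config) (v : L.V) (j : Fin 2) :
    L.evalAt φ (L.coordFun v j) = planeCoord (φ.1 v) j :=
  MvPolynomial.aeval_X _ _

theorem evalFun_algebraMap (φ : L.config) (x : L.CoordRing) :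
    L.evalFun c φ (algebraMap L.CoordRing (L.Functions c) x) = L.evalAt φ x :=
  IsLocalization.lift_eq _ x

theorem evalFun_coord (φ : L.config) (v : L.V) (j : Fin 2) :
    L.evalFun c φ (L.coord c v j) = planeCoord (φ.1 v) j := by
  rw [coord, evalFun_algebraMap, evalAt_coordFun]

/-- The value at a realization as a homomorphism of real algebras. -/
def evalFunₐ (c : FunctionClass) (φ : L.config) : L.Functions c →ₐ[ℝ] ℝ where
  toRingHom := L.evalFun c φ
  commutes' r := by
    change L.evalFun c φ _ = _
    rw [IsScalarTower.algebraMap_apply ℝ L.CoordRing (L.Functions c), evalFun_algebraMap,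
      AlgHom.commutes]

theorem Functions.algHom_ext {R : Type*} [CommRing R] [Algebra ℝ R]
    {f g : L.Functions c →ₐ[ℝ] R} (h : ∀ v j, f (L.coord c v j) = g (L.coord c v j)) : f = g :=
  AlgHom.coe_ringHom_injective (IsLocalization.ringHom_ext (S := L.Functions c) (P := R)
    (j := f.toRingHom) (k := g.toRingHom) (L.denominators c)
    (RingHom.ext fun x => DFunLike.congr_fun (CoordRing.algHom_ext (R := R)
      (f := f.comp (Algebra.algHom ℝ L.CoordRing (L.Functions c)))
      (g := g.comp (Algebra.algHom ℝ L.CoordRing (L.Functions c))) h) x))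

theorem Functions.exists_lift {R : Type*} [CommRing R] [Algebra ℝ R] (k : L.CoordRing →ₐ[ℝ] R)
    (hk : ∀ s : L.denominators c, IsUnit (k s)) :
    ∃ K : L.Functions c →ₐ[ℝ] R, ∀ x, K (algebraMap L.CoordRing (L.Functions c) x) = k x :=
  have h : ∀ x, IsLocalization.lift (M := L.denominators c) (S := L.Functions c)
      (g := (k : L.CoordRing →+* R)) hk (algebraMap L.CoordRing (L.Functions c) x) = k x :=
    fun x => IsLocalization.lift_eq _ x
  ⟨{ IsLocalization.lift (M := L.denominators c) (S := L.Functions c)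
      (g := (k : L.CoordRing →+* R)) hk with
      commutes' := fun r => (h (algebraMap ℝ _ r)).trans (k.commutes r) }, h⟩

/-- If a fraction has no zero on the configuration space, neither has its numerator, which is
therefore an admissible denominator. -/
theorem isUnit_of_evalFun_ne_zero (u : L.Functions .entireRational)
    (hu : ∀ φ, L.evalFun .entireRational φ u ≠ 0) : IsUnit u := by
  obtain ⟨x, s, rfl⟩ := IsLocalization.exists_mk'_eq (L.denominators .entireRational) u
  have hx : x ∈ L.denominators .entireRational := fun φ h0 => hu φ (by
    have := congrArg (L.evalFun .entireRational φ)
      (IsLocalization.mk'_spec (L.Functions .entireRational) x s)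
    rw [map_mul, evalFun_algebraMap, evalFun_algebraMap, h0] at this
    exact (mul_eq_zero.1 this).resolve_right (s.2 φ))
  have h := IsLocalization.map_units (L.Functions .entireRational)
    (⟨x, hx⟩ : L.denominators .entireRational)
  rw [← IsLocalization.mk'_spec (L.Functions .entireRational) x s] at h
  exact isUnit_of_mul_isUnit_left h

theorem continuous_planeCoord (j : Fin 2) : Continuous fun z => planeCoord z j := by
  unfold planeCoord
  split
  exacts [Complex.continuous_re, Complex.continuous_im]

theorem continuous_evalPoly (p : L.Poly) : Continuous fun φ => L.evalPoly φ p := by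
  change Continuous fun φ : L.V → ℂ => MvPolynomial.aeval
    (fun c : L.V × Fin 2 => planeCoord (φ c.1) c.2) p
  simp only [MvPolynomial.aeval_eq_eval]
  exact (MvPolynomial.continuous_eval p).comp
    (continuous_pi fun c => (continuous_planeCoord c.2).comp (continuous_apply c.1))

theorem continuous_evalAt (x : L.CoordRing) : Continuous fun φ => L.evalAt φ x := by
  obtain ⟨p, rfl⟩ := Ideal.Quotient.mk_surjective x
  exact (continuous_evalPoly p).comp continuous_subtype_val

theorem continuous_evalFun (u : L.Functions c) : Continuous fun φ => L.evalFun c φ u := by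
  obtain ⟨x, s, rfl⟩ := IsLocalization.exists_mk'_eq (L.denominators c) u
  have : (fun φ => L.evalFun c φ (IsLocalization.mk' (L.Functions c) x s)) =
      fun φ => L.evalAt φ x / L.evalAt φ s := by
    funext φ
    rw [eq_div_iff (L.evalAt_denominator c φ s).ne_zero, ← evalFun_algebraMap (c := c),
      ← evalFun_algebraMap (c := c), ← map_mul, IsLocalization.mk'_spec]
  rw [this]
  exact (continuous_evalAt x).div (continuous_evalAt _)
    fun φ => (L.evalAt_denominator c φ s).ne_zero

/-- A homomorphism from a coordinate ring that induces a map of configuration spaces extends to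
functions of class `c`. -/
theorem exists_functions_lift (k : L.CoordRing →ₐ[ℝ] L'.Functions c) (σ : L'.config → L.config)
    (hk : ∀ φ v j, L'.evalFun c φ (k (L.coordFun v j)) = planeCoord ((σ φ).1 v) j) :
    ∃ K : L.Functions c →ₐ[ℝ] L'.Functions c,
      (∀ v j, K (L.coord c v j) = k (L.coordFun v j)) ∧
        ∀ φ u, L'.evalFun c φ (K u) = L.evalFun c (σ φ) u := by
  have hk' : ∀ φ, (evalFunₐ c φ).comp k = L.evalAt (σ φ) := fun φ =>
    CoordRing.algHom_ext fun v j => (hk φ v j).trans (evalAt_coordFun _ _ _).symm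
  -- The value of `k s` at `φ` is the value of `s` at `σ φ`, so a denominator without zeros stays
  -- without zeros and is invertible in the target.
  have hunit : ∀ s : L.denominators c, IsUnit (k s) := by
    rintro ⟨s, hs⟩
    cases c with
    | polynomial =>
      obtain rfl : s = 1 := hs
      rw [map_one]
      exact isUnit_one
    | entireRational =>
      refine isUnit_of_evalFun_ne_zero _ fun φ h0 => hs (σ φ) ?_
      rw [← hk' φ]
      exact h0
  obtain ⟨K, hK⟩ := Functions.exists_lift (R := L'.Functions c) k hunit
  have hK : ∀ v j, K (L.coord c v j) = k (L.coordFun v j) := fun v j => hK _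
  refine ⟨K, hK, fun φ u => ?_⟩
  have : (evalFunₐ c φ).comp K = evalFunₐ c (σ φ) := Functions.algHom_ext fun v j => by
    change L'.evalFun c φ (K _) = L.evalFun c _ _
    rw [hK, hk, evalFun_coord]
  exact DFunLike.congr_fun this u

end Functions

/-! ### Functions and automorphisms of a fiber sum -/

section FiberSum

variable {A B : MarkedLinkage} {τ : Type} {a : τ ↪ A.V} {b : τ ↪ B.V} {c : FunctionClass}

theorem exists_functionsLeft : ∃ K : A.Functions c →ₐ[ℝ] (fiberSum A B a b).Functions c,
    (∀ v j, K (A.coord c v j) = (fiberSum A B a b).coord c (glueInl A B a b v) j) ∧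
      ∀ φ u, (fiberSum A B a b).evalFun c φ (K u) =
        A.evalFun c (restrictLeft A B a b φ) u := by
  obtain ⟨K, hK, hK'⟩ := exists_functions_lift (c := c)
    ((Algebra.algHom ℝ (fiberSum A B a b).CoordRing ((fiberSum A B a b).Functions c)).comp
      (coordLeft A B a b)) (restrictLeft A B a b) fun φ v j => by
        rw [AlgHom.comp_apply, coordLeft_coordFun]
        exact evalFun_coord _ _ _
  refine ⟨K, fun v j => ?_, hK'⟩
  rw [hK, AlgHom.comp_apply, coordLeft_coordFun]
  rfl

theorem exists_functionsRight : ∃ K : B.Functions c →ₐ[ℝ] (fiberSum A B a b).Functions c,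
    (∀ v j, K (B.coord c v j) = (fiberSum A B a b).coord c (glueInr A B a b v) j) ∧
      ∀ φ u, (fiberSum A B a b).evalFun c φ (K u) =
        B.evalFun c (restrictRight A B a b φ) u := by
  obtain ⟨K, hK, hK'⟩ := exists_functions_lift (c := c)
    ((Algebra.algHom ℝ (fiberSum A B a b).CoordRing ((fiberSum A B a b).Functions c)).comp
      (coordRight A B a b)) (restrictRight A B a b) fun φ v j => by
        rw [AlgHom.comp_apply, coordRight_coordFun]
        exact evalFun_coord _ _ _
  refine ⟨K, fun v j => ?_, hK'⟩
  rw [hK, AlgHom.comp_apply, coordRight_coordFun]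
  rfl

/-- Both endomorphisms fix the coordinates of the glued vertices, so after inclusion they agree
there and define a homomorphism on the pushout. It extends to fractions because it induces the map
`σ` on realizations. -/
theorem exists_functions_glue (jA : A.Functions c →ₐ[ℝ] (fiberSum A B a b).Functions c)
    (hjA : ∀ v j, jA (A.coord c v j) = (fiberSum A B a b).coord c (glueInl A B a b v) j)
    (hjA' : ∀ φ u, (fiberSum A B a b).evalFun c φ (jA u) =
        A.evalFun c (restrictLeft A B a b φ) u)
    (jB : B.Functions c →ₐ[ℝ] (fiberSum A B a b).Functions c)
    (hjB : ∀ v j, jB (B.coord c v j) = (fiberSum A B a b).coord c (glueInr A B a b v) j)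
    (hjB' : ∀ φ u, (fiberSum A B a b).evalFun c φ (jB u) =
        B.evalFun c (restrictRight A B a b φ) u)
    (σ : (fiberSum A B a b).config → (fiberSum A B a b).config)
    (eA : A.Functions c →ₐ[ℝ] A.Functions c) (eB : B.Functions c →ₐ[ℝ] B.Functions c)
    (σA : A.config → A.config) (σB : B.config → B.config)
    (hσA : ∀ φ, restrictLeft A B a b (σ φ) = σA (restrictLeft A B a b φ))
    (hσB : ∀ φ, restrictRight A B a b (σ φ) = σB (restrictRight A B a b φ))
    (hA : ∀ φ u, A.evalFun c φ (eA u) = A.evalFun c (σA φ) u)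
    (hB : ∀ φ u, B.evalFun c φ (eB u) = B.evalFun c (σB φ) u)
    (ha : ∀ t j, eA (A.coord c (a t) j) = A.coord c (a t) j)
    (hb : ∀ t j, eB (B.coord c (b t) j) = B.coord c (b t) j) :
    ∃ K : (fiberSum A B a b).Functions c →ₐ[ℝ] (fiberSum A B a b).Functions c,
      (∀ φ u, (fiberSum A B a b).evalFun c φ (K u) = (fiberSum A B a b).evalFun c (σ φ) u) ∧
      (∀ u, K (jA u) = jA (eA u)) ∧ ∀ u, K (jB u) = jB (eB u) := by
  obtain ⟨k, hkl, hkr⟩ := exists_coordRing_lift (a := a) (b := b)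
    (R := (fiberSum A B a b).Functions c)
    (jA.comp (eA.comp (Algebra.algHom ℝ A.CoordRing (A.Functions c))))
    (jB.comp (eB.comp (Algebra.algHom ℝ B.CoordRing (B.Functions c)))) fun t j => by
      change jA (eA (A.coord c (a t) j)) = jB (eB (B.coord c (b t) j))
      rw [ha, hb, hjA, hjB, glue_eq]
  have hl : ∀ v j, k ((fiberSum A B a b).coordFun (glueInl A B a b v) j) =
      jA (eA (A.coord c v j)) := fun v j => by
    rw [← coordLeft_coordFun]
    exact DFunLike.congr_fun hkl _
  have hr : ∀ v j, k ((fiberSum A B a b).coordFun (glueInr A B a b v) j) =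
      jB (eB (B.coord c v j)) := fun v j => by
    rw [← coordRight_coordFun]
    exact DFunLike.congr_fun hkr _
  obtain ⟨K, hK, hK'⟩ := exists_functions_lift k σ fun φ v j => by
    induction v using glueV_cases with
    | hl v =>
      rw [hl, hjA', hA, evalFun_coord, ← hσA]
      rfl
    | hr v =>
      rw [hr, hjB', hB, evalFun_coord, ← hσB]
      rfl
  refine ⟨K, hK', ?_, ?_⟩
  · refine DFunLike.congr_fun (f := K.comp jA) (g := jA.comp eA)
      (Functions.algHom_ext (R := (fiberSum A B a b).Functions c) fun v j => ?_)
    rw [AlgHom.comp_apply, AlgHom.comp_apply, hjA]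
    exact (hK _ j).trans (hl v j)
  · refine DFunLike.congr_fun (f := K.comp jB) (g := jB.comp eB)
      (Functions.algHom_ext (R := (fiberSum A B a b).Functions c) fun v j => ?_)
    rw [AlgHom.comp_apply, AlgHom.comp_apply, hjB]
    exact (hK _ j).trans (hr v j)

/-- Automorphisms of two linkages that fix the glued vertices induce an automorphism of the fiber
sum. -/
theorem exists_functions_glueEquiv (σ : Equiv.Perm (fiberSum A B a b).config)
    (eA : A.Functions c ≃ₐ[ℝ] A.Functions c) (eB : B.Functions c ≃ₐ[ℝ] B.Functions c)
    (σA : Equiv.Perm A.config) (σB : Equiv.Perm B.config)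
    (hσA : ∀ φ, restrictLeft A B a b (σ φ) = σA (restrictLeft A B a b φ))
    (hσB : ∀ φ, restrictRight A B a b (σ φ) = σB (restrictRight A B a b φ))
    (hA : ∀ φ u, A.evalFun c φ (eA u) = A.evalFun c (σA φ) u)
    (hB : ∀ φ u, B.evalFun c φ (eB u) = B.evalFun c (σB φ) u)
    (ha : ∀ t j, eA (A.coord c (a t) j) = A.coord c (a t) j)
    (hb : ∀ t j, eB (B.coord c (b t) j) = B.coord c (b t) j) :
    ∃ e : (fiberSum A B a b).Functions c ≃ₐ[ℝ] (fiberSum A B a b).Functions c,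
      (∀ φ u, (fiberSum A B a b).evalFun c φ (e u) = (fiberSum A B a b).evalFun c (σ φ) u) ∧
      (∀ v, (∀ j, eA (A.coord c v j) = A.coord c v j) → ∀ j,
        e ((fiberSum A B a b).coord c (glueInl A B a b v) j) =
          (fiberSum A B a b).coord c (glueInl A B a b v) j) ∧
      ∀ v, (∀ j, eB (B.coord c v j) = B.coord c v j) → ∀ j,
        e ((fiberSum A B a b).coord c (glueInr A B a b v) j) =
          (fiberSum A B a b).coord c (glueInr A B a b v) j := by
  obtain ⟨jA, hjA, hjA'⟩ := exists_functionsLeft (A := A) (B := B) (a := a) (b := b) (c := c)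
  obtain ⟨jB, hjB, hjB'⟩ := exists_functionsRight (A := A) (B := B) (a := a) (b := b) (c := c)
  obtain ⟨K, hK, hKA, hKB⟩ := exists_functions_glue jA hjA hjA' jB hjB hjB' σ eA.toAlgHom eB.toAlgHom
    σA σB
    hσA hσB hA hB ha hb
  -- Gluing the inverse automorphisms produces the inverse of `K`.
  obtain ⟨K', -, hKA', hKB'⟩ := exists_functions_glue jA hjA hjA' jB hjB hjB' σ.symm
    eA.symm.toAlgHom eB.symm.toAlgHom σA.symm σB.symm
    (fun φ => by rw [Equiv.eq_symm_apply, ← hσA, Equiv.apply_symm_apply])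
    (fun φ => by rw [Equiv.eq_symm_apply, ← hσB, Equiv.apply_symm_apply])
    (fun φ u => by
      have := hA (σA.symm φ) (eA.symm u)
      rw [AlgEquiv.apply_symm_apply, Equiv.apply_symm_apply] at this
      exact this.symm)
    (fun φ u => by
      have := hB (σB.symm φ) (eB.symm u)
      rw [AlgEquiv.apply_symm_apply, Equiv.apply_symm_apply] at this
      exact this.symm)
    (fun t j => eA.symm_apply_eq.2 (ha t j).symm) (fun t j => eB.symm_apply_eq.2 (hb t j).symm)
  have h1 : K.comp K' = AlgHom.id ℝ _ := Functions.algHom_ext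
    (R := (fiberSum A B a b).Functions c) fun v j => by
    induction v using glueV_cases with
    | hl v =>
      rw [← hjA, AlgHom.comp_apply, hKA', hKA]
      exact congrArg jA (eA.apply_symm_apply _)
    | hr v =>
      rw [← hjB, AlgHom.comp_apply, hKB', hKB]
      exact congrArg jB (eB.apply_symm_apply _)
  have h2 : K'.comp K = AlgHom.id ℝ _ := Functions.algHom_ext
    (R := (fiberSum A B a b).Functions c) fun v j => by
    induction v using glueV_cases with
    | hl v =>
      rw [← hjA, AlgHom.comp_apply, hKA, hKA']
      exact congrArg jA (eA.symm_apply_apply _)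
    | hr v =>
      rw [← hjB, AlgHom.comp_apply, hKB, hKB']
      exact congrArg jB (eB.symm_apply_apply _)
  refine ⟨AlgEquiv.ofAlgHom K K' h1 h2, hK, fun v hv j => ?_, fun v hv j => ?_⟩
  · change K _ = _
    rw [← hjA, hKA]
    exact congrArg jA (hv j)
  · change K _ = _
    rw [← hjB, hKB]
    exact congrArg jB (hv j)

end FiberSum

end MarkedLinkage

namespace IOLinkage

variable {ι κ τ ρ : Type}

/-- The glued vertices are inputs of `A` and outputs of `B`, hence fixed by both automorphisms. -/
theorem isSchemeAut_comp {c : FunctionClass} {A : IOLinkage (τ ⊕ ρ) κ} {B : IOLinkage ι τ}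
    {σ : Equiv.Perm (A.comp B).config} {σA : Equiv.Perm A.config} {σB : Equiv.Perm B.config}
    (hσA : ∀ φ, resA A B (σ φ) = σA (resA A B φ)) (hσB : ∀ φ, resB A B (σ φ) = σB (resB A B φ))
    (hA : A.IsSchemeAut c σA) (hB : B.IsSchemeAut c σB) : (A.comp B).IsSchemeAut c σ := by
  obtain ⟨eA, hA, hiA, hoA⟩ := hA
  obtain ⟨eB, hB, hiB, hoB⟩ := hB
  obtain ⟨e, he, hl, hr⟩ := MarkedLinkage.exists_functions_glueEquiv
    (a := Function.Embedding.inl.trans A.input) (b := B.output) (c := c) σ eA eB σA σB hσA hσB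
    hA hB (fun t j => hiA (Sum.inl t) j) hoB
  refine ⟨e, he, ?_, fun k j => hl _ (hoA k) j⟩
  rintro (i | r) j
  · exact hr _ (hiB i) j
  · exact hl _ (hiA (Sum.inr r)) j

/-- Bijections induced by automorphisms of the configuration scheme are continuous. -/
theorem IsSchemeAut.continuous {c : FunctionClass} {L : IOLinkage ι κ}
    {σ : Equiv.Perm L.config} (h : L.IsSchemeAut c σ) : Continuous σ := by
  obtain ⟨e, he, -⟩ := h
  refine Continuous.subtype_mk (continuous_pi fun v => ?_) _
  -- The coordinates of `σ φ` are the values at `φ` of the functions `e (coord v j)`.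
  have hc : ∀ j, Continuous fun φ => planeCoord ((σ φ).1 v) j := fun j => by
    simp only [← MarkedLinkage.evalFun_coord (c := c), ← he]
    exact MarkedLinkage.continuous_evalFun _
  have : (fun φ => (σ φ).1 v) = fun φ =>
      (planeCoord ((σ φ).1 v) 0 : ℂ) + planeCoord ((σ φ).1 v) 1 * Complex.I := by
    funext φ
    simp [planeCoord]
  change Continuous fun φ => (σ φ).1 v
  rw [this]
  exact (Complex.continuous_ofReal.comp (hc 0)).add
    ((Complex.continuous_ofReal.comp (hc 1)).mul continuous_const)

end IOLinkage

/-! ## The maps between the real and the complex field -/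

/-- If `I` vanished, every element would be real and `-1` would have no square root. -/
theorem RCLike.I_ne_zero_of_isAlgClosed (𝕜 : Type*) [RCLike 𝕜] [IsAlgClosed 𝕜] :
    (RCLike.I : 𝕜) ≠ 0 := by
  intro h
  obtain ⟨z, hz⟩ := IsAlgClosed.exists_pow_nat_eq (-1 : 𝕜) (n := 2) two_pos
  rw [← RCLike.re_add_im z, h, mul_zero, add_zero] at hz
  have h1 : RCLike.re z ^ 2 = -1 := by
    exact_mod_cast hz
  nlinarith [sq_nonneg (RCLike.re z)]

theorem RCLike.map_complex_map (𝕜 : Type*) [RCLike 𝕜] (x : 𝕜) :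
    RCLike.map ℂ 𝕜 (RCLike.map 𝕜 ℂ x) = x := by
  simp [RCLike.map_apply, RCLike.re_add_im]

theorem RCLike.map_map_complex {𝕜 : Type*} [RCLike 𝕜] (h : (RCLike.I : 𝕜) ≠ 0) (z : ℂ) :
    RCLike.map 𝕜 ℂ (RCLike.map ℂ 𝕜 z) = z := by
  have h1 : RCLike.im (RCLike.I : 𝕜) = 1 := by
    rcases RCLike.I_eq_zero_or_im_I_eq_one (K := 𝕜) with h0 | h1
    exacts [absurd h0 h, h1]
  simp [RCLike.map_apply, h1, Complex.re_add_im]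

/-! ## Gluing of realizations -/

namespace MarkedLinkage

variable {A B : MarkedLinkage} {τ : Type} {a : τ ↪ A.V} {b : τ ↪ B.V} {X : Type*}

/-- The map on the vertices of a fiber sum given by maps on the vertices of the two linkages. -/
def glueFun (a : τ ↪ A.V) (b : τ ↪ B.V) (φ : A.V → X) (ψ : B.V → X) (v : GlueV A B a b) : X :=
  Sum.elim φ ψ v.out

/-- `glueFun` evaluates at a chosen representative, so it makes sense for incompatible pairs too;
compatibility makes the choice irrelevant. -/
theorem glueFun_mk {φ : A.V → X} {ψ : B.V → X} (h : ∀ t, φ (a t) = ψ (b t)) (x : A.V ⊕ B.V) :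
    glueFun a b φ ψ (Quot.mk _ x) = Sum.elim φ ψ x := by
  exact congrArg (Quot.lift (r := GlueRel A B a b) (Sum.elim φ ψ)
    (by rintro _ _ ⟨t, rfl, rfl⟩; exact h t)) (Quot.out_eq (Quot.mk (GlueRel A B a b) x))

end MarkedLinkage

namespace IOLinkage

open MarkedLinkage

variable {ι κ τ ρ : Type} (A : IOLinkage (τ ⊕ ρ) κ) (B : IOLinkage ι τ)

theorem comp_config_ext {φ ψ : (A.comp B).config} (hA : resA A B φ = resA A B ψ)
    (hB : resB A B φ = resB A B ψ) : φ = ψ := by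
  refine Subtype.ext (funext fun v => ?_)
  refine glueV_cases _ _ _ _ (p := fun v => φ.1 v = ψ.1 v) (fun v => ?_) (fun v => ?_) v
  · exact congrFun (congrArg Subtype.val hA) v
  · exact congrFun (congrArg Subtype.val hB) v

theorem resA_input (φ : (A.comp B).config) (t : τ) :
    (resA A B φ).1 (A.input (Sum.inl t)) = (resB A B φ).1 (B.output t) :=
  congrArg φ.1 (glue_eq A.toMarkedLinkage B.toMarkedLinkage
    (Function.Embedding.inl.trans A.input) B.output t)

/-- Realizations of two linkages with the same positions of the glued vertices are the
restrictions of a realization of the composition. -/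
theorem exists_comp_config (φ : A.config) (ψ : B.config)
    (h : ∀ t, φ.1 (A.input (Sum.inl t)) = ψ.1 (B.output t)) :
    ∃ η : (A.comp B).config, resA A B η = φ ∧ resB A B η = ψ := by
  have hg := glueFun_mk (a := Function.Embedding.inl.trans A.input) (b := B.output) h
  have hl : ∀ v, glueFun (Function.Embedding.inl.trans A.input) B.output φ.1 ψ.1
    (glueInl _ _ _ _ v) = φ.1 v := fun v => hg (Sum.inl v)
  have hr : ∀ v, glueFun (Function.Embedding.inl.trans A.input) B.output φ.1 ψ.1
    (glueInr _ _ _ _ v) = ψ.1 v := fun v => hg (Sum.inr v)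
  refine ⟨⟨glueFun (Function.Embedding.inl.trans A.input) B.output φ.1 ψ.1, ?_, ?_⟩,
    Subtype.ext (funext hl), Subtype.ext (funext hr)⟩
  · rintro (e | e)
    · change ‖glueFun _ _ _ _ (glueInl _ _ _ _ _) - glueFun _ _ _ _ (glueInl _ _ _ _ _)‖ ^ 2 = _
      rw [hl, hl]
      exact φ.2.1 e
    · change ‖glueFun _ _ _ _ (glueInr _ _ _ _ _) - glueFun _ _ _ _ (glueInr _ _ _ _ _)‖ ^ 2 = _
      rw [hr, hr]
      exact ψ.2.1 e
  · rintro (m | m)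
    · exact (hl _).trans (φ.2.2 m)
    · exact (hr _).trans (ψ.2.2 m)

theorem continuous_resA : Continuous (resA A B) :=
  Continuous.subtype_mk (f := fun φ : (A.comp B).config => fun v : A.V =>
    φ.1 (glueInl _ _ _ _ v)) (continuous_pi fun _ => (continuous_apply _).comp
      continuous_subtype_val) _

theorem continuous_resB : Continuous (resB A B) :=
  Continuous.subtype_mk (f := fun φ : (A.comp B).config => fun v : B.V =>
    φ.1 (glueInr _ _ _ _ v)) (continuous_pi fun _ => (continuous_apply _).comp
      continuous_subtype_val) _

/-- `glueFun` depends continuously on the pair even off the compatible ones, and it recovers a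
realization from its restrictions. -/
theorem isInducing_res :
    IsInducing fun φ : (A.comp B).config => (resA A B φ, resB A B φ) := by
  let g : A.config × B.config →
      (GlueV A.toMarkedLinkage B.toMarkedLinkage (Function.Embedding.inl.trans A.input) B.output →
        ℂ) := fun z => glueFun _ _ z.1.1 z.2.1
  have hg : Continuous g := by
    refine continuous_pi fun v => ?_
    change Continuous fun z : A.config × B.config => Sum.elim z.1.1 z.2.1 v.out
    cases v.out with
    | inl v => exact (continuous_apply v).comp (continuous_subtype_val.comp continuous_fst)
    | inr v => exact (continuous_apply v).comp (continuous_subtype_val.comp continuous_snd)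
  refine IsInducing.of_comp ((continuous_resA A B).prodMk (continuous_resB A B)) hg ?_
  have : (g ∘ fun φ : (A.comp B).config => (resA A B φ, resB A B φ)) = Subtype.val := by
    funext φ v
    obtain ⟨x, rfl⟩ := Quot.exists_rep v
    refine (glueFun_mk (resA_input A B φ) x).trans ?_
    cases x <;> rfl
  rw [this]
  exact IsInducing.subtypeVal

/-! ## Input maps -/

section InputMap

variable (L : IOLinkage ι κ) {𝕜 : Type} [RCLike 𝕜]

theorem inputMap_apply (φ : L.V → ℂ) (i : ι) :
    L.inputMap 𝕜 φ i = RCLike.map ℂ 𝕜 (φ (L.input i)) := rfl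

theorem inputMap_complex_apply (φ : L.V → ℂ) (i : ι) :
    L.inputMap ℂ φ i = φ (L.input i) := by
  rw [inputMap_apply, RCLike.map_same_eq_id]
  rfl

variable {L} {c : FunctionClass} {G : Subgroup (Equiv.Perm L.config)} {F : (ι → 𝕜) → κ → ℂ}

/-! ### Consequences of being a quotient by a finite group -/

namespace ComputesWithGroup

theorem inputMap_perm (h : L.ComputesWithGroup 𝕜 c G F) {σ : Equiv.Perm L.config} (hσ : σ ∈ G)
    (φ : L.config) : L.inputMap 𝕜 (σ φ).1 = L.inputMap 𝕜 φ.1 :=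
  ((h.fiber_iff φ (σ φ)).2 ⟨σ, hσ, rfl⟩).symm

theorem input_perm (h : L.ComputesWithGroup 𝕜 c G F) {σ : Equiv.Perm L.config} (hσ : σ ∈ G)
    (φ : L.config) (i : ι) : (σ φ).1 (L.input i) = φ.1 (L.input i) := by
  rw [← h.input_mem, ← h.input_mem, h.inputMap_perm hσ]

theorem output_perm (h : L.ComputesWithGroup 𝕜 c G F) {σ : Equiv.Perm L.config} (hσ : σ ∈ G)
    (φ : L.config) (k : κ) : (σ φ).1 (L.output k) = φ.1 (L.output k) :=
  congrFun (((h.output_eq (σ φ)).trans (congrArg F (h.inputMap_perm hσ φ))).trans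
    (h.output_eq φ).symm) k

theorem continuous_perm (h : L.ComputesWithGroup 𝕜 c G F) {σ : Equiv.Perm L.config}
    (hσ : σ ∈ G) : Continuous σ :=
  (h.scheme_aut σ hσ).continuous

/-- The quotient map by a finite group is open. -/
theorem isOpenMap_inputOnto (h : L.ComputesWithGroup 𝕜 c G F) : IsOpenMap (L.inputOnto 𝕜) := by
  intro U hU
  rw [← h.isQuotientMap.isOpen_preimage]
  -- Fibers are orbits, so the saturation of `U` is a union of translates.
  have : L.inputOnto 𝕜 ⁻¹' (L.inputOnto 𝕜 '' U) = ⋃ σ : G, (σ : Equiv.Perm L.config) ⁻¹' U := by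
    ext φ
    simp only [Set.mem_preimage, Set.mem_image, Set.mem_iUnion]
    constructor
    · rintro ⟨ψ, hψ, he⟩
      obtain ⟨σ, hσ, rfl⟩ := (h.fiber_iff φ ψ).1 (congrArg Subtype.val he).symm
      exact ⟨⟨σ, hσ⟩, hψ⟩
    · rintro ⟨σ, hσ⟩
      exact ⟨_, hσ, Subtype.ext (h.inputMap_perm σ.2 φ)⟩
  rw [this]
  exact isOpen_iUnion fun σ => hU.preimage (h.continuous_perm σ.2)

/-- Continuity descends along the quotient map from the output map, which is a tuple of coordinates.
-/
theorem continuousOn_dom (h : L.ComputesWithGroup 𝕜 c G F) : ContinuousOn F (L.dom 𝕜) := by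
  rw [continuousOn_iff_continuous_domRestrict, h.isQuotientMap.continuous_iff]
  have : (L.dom 𝕜).domRestrict F ∘ L.inputOnto 𝕜 = L.outputMap := by
    funext φ
    exact (h.output_eq φ).symm
  rw [this]
  exact continuous_pi fun k => (continuous_apply (L.output k)).comp continuous_subtype_val

theorem isClosed_wall (h : L.ComputesWithGroup 𝕜 c G F) : IsClosed (L.wall G) := by
  have : L.wall G = ⋃ σ : {σ : G // σ ≠ 1}, {φ | σ.1.1 φ = φ} := by
    ext φ
    simp only [wall, Set.mem_ofPred_eq, Set.mem_iUnion, Subtype.exists, ne_eq, Subgroup.mk_eq_one,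
      exists_prop]
  have := h.finite_group
  rw [‹L.wall G = _›]
  exact isClosed_iUnion_of_finite fun σ => isClosed_eq (h.continuous_perm σ.1.2) continuous_id

end ComputesWithGroup

end InputMap

/-! ## The composition of linkages -/

section Comp

variable {A B} {𝕜 : Type} [RCLike 𝕜]
variable {c : FunctionClass} {GA : Subgroup (Equiv.Perm A.config)}
  {GB : Subgroup (Equiv.Perm B.config)} {f : (τ ⊕ ρ → ℂ) → κ → ℂ} {g : (ι → 𝕜) → τ → ℂ}

theorem inputMap_comp (φ : (A.comp B).config) : (A.comp B).inputMap 𝕜 φ.1 =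
    Sum.elim (B.inputMap 𝕜 (resB A B φ).1)
      fun r => RCLike.map ℂ 𝕜 (A.inputMap ℂ (resA A B φ).1 (Sum.inr r)) := by
  funext x
  rcases x with i | r
  · rfl
  · rw [Sum.elim_inr, inputMap_complex_apply]
    rfl

theorem resA_inputMap_inl (hB : B.ComputesWithGroup 𝕜 c GB g) (φ : (A.comp B).config) (t : τ) :
    A.inputMap ℂ (resA A B φ).1 (Sum.inl t) = g (B.inputMap 𝕜 (resB A B φ).1) t := by
  rw [inputMap_complex_apply, resA_input, ← hB.output_eq]
  rfl

/-- The glued inputs of `A` are recovered through `g`. The others are recovered only if passing to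
`𝕜` drops no imaginary part, which is the role of `hρ`. -/
theorem resA_inputMap (hρ : ρ → (RCLike.I : 𝕜) ≠ 0) (hB : B.ComputesWithGroup 𝕜 c GB g)
    (φ : (A.comp B).config) : A.inputMap ℂ (resA A B φ).1 =
      Sum.elim (g fun i => (A.comp B).inputMap 𝕜 φ.1 (Sum.inl i))
        fun r => RCLike.map 𝕜 ℂ ((A.comp B).inputMap 𝕜 φ.1 (Sum.inr r)) := by
  funext x
  rw [inputMap_comp]
  rcases x with t | r
  · exact resA_inputMap_inl hB φ t
  · exact (RCLike.map_map_complex (hρ r) _).symm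

/-- Realizations of `A` and `B` whose inputs fit together come from the composition. -/
theorem exists_comp_config_of_inputMap (hB : B.ComputesWithGroup 𝕜 c GB g) {φ : A.config}
    {ψ : B.config} (h : ∀ t, A.inputMap ℂ φ.1 (Sum.inl t) = g (B.inputMap 𝕜 ψ.1) t) :
    ∃ η : (A.comp B).config, resA A B η = φ ∧ resB A B η = ψ := by
  refine exists_comp_config A B φ ψ fun t => ?_
  rw [← inputMap_complex_apply A φ.1, h, ← hB.output_eq]
  rfl

variable [Fintype ι] [Fintype τ] [Fintype ρ]

theorem mem_comp_dom (hB : B.ComputesWithGroup 𝕜 c GB g) {x : τ ⊕ ρ → ℂ} {y : ι → 𝕜}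
    (h : (x, y) ∈ domProduct 𝕜 A B g) :
    (Sum.elim y fun r => RCLike.map ℂ 𝕜 (x (Sum.inr r))) ∈ (A.comp B).dom 𝕜 := by
  obtain ⟨⟨φ, hφ, rfl⟩, ⟨ψ, hψ, rfl⟩, h⟩ := h
  obtain ⟨η, hA, hB⟩ := exists_comp_config_of_inputMap (φ := ⟨φ, hφ⟩) (ψ := ⟨ψ, hψ⟩) hB (congrFun h)
  refine ⟨η.1, η.2, ?_⟩
  rw [inputMap_comp, hA, hB]

/-- The input maps of the two linkages on the realizations of the composition. -/
def compInput (hB : B.ComputesWithGroup 𝕜 c GB g) (φ : (A.comp B).config) :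
    domProduct 𝕜 A B g :=
  ⟨(A.inputMap ℂ (resA A B φ).1, B.inputMap 𝕜 (resB A B φ).1), ⟨_, (resA A B φ).2, rfl⟩,
    ⟨_, (resB A B φ).2, rfl⟩, funext (resA_inputMap_inl hB φ)⟩

/-- A product of open maps is open, and so is its restriction to the full preimage of a subset. The
realizations of the composition are the full preimage of the fiber product of the domains. -/
theorem isOpenMap_compInput (hA : A.ComputesWithGroup ℂ c GA f)
    (hB : B.ComputesWithGroup 𝕜 c GB g) : IsOpenMap (compInput (A := A) hB) := by
  intro U hU
  obtain ⟨W, hW, rfl⟩ := (isInducing_res A B).isOpen_iff.1 hU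
  have hW' := (hA.isOpenMap_inputOnto.prodMap hB.isOpenMap_inputOnto) W hW
  have hc : Continuous fun z : domProduct 𝕜 A B g =>
      ((⟨z.1.1, z.2.1⟩ : A.dom ℂ), (⟨z.1.2, z.2.2.1⟩ : B.dom 𝕜)) :=
    ((continuous_fst.comp continuous_subtype_val).subtype_mk _).prodMk
      ((continuous_snd.comp continuous_subtype_val).subtype_mk _)
  convert hW'.preimage hc using 1
  ext z
  constructor
  · rintro ⟨φ, hφ, rfl⟩
    exact ⟨_, hφ, rfl⟩
  · rintro ⟨⟨φ, ψ⟩, hφ, he⟩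
    have h1 : A.inputMap ℂ φ.1 = z.1.1 := congrArg Subtype.val (congrArg Prod.fst he)
    have h2 : B.inputMap 𝕜 ψ.1 = z.1.2 := congrArg Subtype.val (congrArg Prod.snd he)
    obtain ⟨η, rfl, rfl⟩ := exists_comp_config_of_inputMap (A := A) (φ := φ) (ψ := ψ) hB (by
      rw [h1, h2]
      exact congrFun z.2.2.2)
    exact ⟨η, hφ, Subtype.ext (Prod.ext h1 h2)⟩

theorem continuous_compInput (hB : B.ComputesWithGroup 𝕜 c GB g) :
    Continuous (compInput (A := A) hB) :=
  (((A.inputMap ℂ).continuous.comp (continuous_subtype_val.comp (continuous_resA A B))).prodMk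
    ((B.inputMap 𝕜).continuous.comp
      (continuous_subtype_val.comp (continuous_resB A B)))).subtype_mk _

/-- The domain of the composition is the fiber product of the domains. -/
def domHomeomorph (hρ : ρ → (RCLike.I : 𝕜) ≠ 0) (hB : B.ComputesWithGroup 𝕜 c GB g) :
    domProduct 𝕜 A B g ≃ₜ (A.comp B).dom 𝕜 where
  toFun z := ⟨_, mem_comp_dom hB z.2⟩
  invFun w := ⟨(Sum.elim (g fun i => w.1 (Sum.inl i)) fun r => RCLike.map 𝕜 ℂ (w.1 (Sum.inr r)),
    fun i => w.1 (Sum.inl i)), by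
      obtain ⟨_, φ, hφ, rfl⟩ := w
      have h : (A.inputMap ℂ (resA A B ⟨φ, hφ⟩).1, B.inputMap 𝕜 (resB A B ⟨φ, hφ⟩).1) ∈
        domProduct 𝕜 A B g := (compInput hB ⟨φ, hφ⟩).2
      rw [resA_inputMap hρ hB] at h
      exact h⟩
  left_inv z := by
    refine Subtype.ext (Prod.ext (funext fun x => ?_) rfl)
    rcases x with t | r
    · exact (congrFun z.2.2.2 t).symm
    · exact RCLike.map_map_complex (hρ r) _
  right_inv w := by
    refine Subtype.ext (funext fun x => ?_)
    rcases x with i | r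
    · rfl
    · exact RCLike.map_complex_map 𝕜 _
  continuous_toFun := by
    refine Continuous.subtype_mk (continuous_pi fun x => ?_) _
    rcases x with i | r
    · exact (continuous_apply i).comp (continuous_snd.comp continuous_subtype_val)
    · exact (RCLike.map ℂ 𝕜).continuous.comp ((continuous_apply (Sum.inr r)).comp
        (continuous_fst.comp continuous_subtype_val))
  continuous_invFun := by
    have h1 : Continuous fun w : (A.comp B).dom 𝕜 => fun i => w.1 (Sum.inl i) :=
      continuous_pi fun i => (continuous_apply (Sum.inl i)).comp continuous_subtype_val
    refine Continuous.subtype_mk (Continuous.prodMk (continuous_pi fun x => ?_) h1) _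
    rcases x with t | r
    -- The function `g` is known to be continuous only on the domain of `B`, so its argument must be
    -- shown to stay there.
    · refine (continuous_apply t).comp (hB.continuousOn_dom.comp_continuous h1 ?_)
      rintro ⟨_, φ, hφ, rfl⟩
      exact (compInput hB ⟨φ, hφ⟩).2.2.1
    · exact (RCLike.map 𝕜 ℂ).continuous.comp ((continuous_apply (Sum.inr r)).comp
        continuous_subtype_val)

end Comp

end IOLinkage

/-! ## Semi-algebraic graphs -/

section Semialgebraic

variable {X : Type*} [AddCommGroup X] [Module ℝ X]

theorem IsSemialgebraic.univ : IsSemialgebraic (Set.univ : Set X) := by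
  convert IsSemialgebraic.pos (X := X) 1 (one_mem _) using 1
  ext x
  simp

theorem IsSemialgebraic.inter {S T : Set X} (hS : IsSemialgebraic S) (hT : IsSemialgebraic T) :
    IsSemialgebraic (S ∩ T) := by
  rw [← compl_compl (S ∩ T), Set.compl_inter]
  exact ((hS.compl).union _ _ hT.compl).compl

theorem IsSemialgebraic.finite_iInter {I : Type*} [Finite I] {S : I → Set X}
    (hS : ∀ i, IsSemialgebraic (S i)) : IsSemialgebraic (⋂ i, S i) := by
  have := Fintype.ofFinite I
  have h : ∀ s : Finset I, IsSemialgebraic (⋂ i ∈ s, S i) := fun s => by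
    classical
    induction s using Finset.induction_on with
    | empty => simpa using IsSemialgebraic.univ
    | insert i s _ ih =>
      rw [Finset.set_biInter_insert]
      exact (hS i).inter ih
  simpa using h Finset.univ

theorem isSemialgebraic_linear_eq_zero (l : X →ₗ[ℝ] ℝ) : IsSemialgebraic {x | l x = 0} := by
  have h : ∀ l : X →ₗ[ℝ] ℝ, IsSemialgebraic {x | 0 < l x} := fun l =>
    IsSemialgebraic.pos _ (Algebra.subset_adjoin ⟨l, rfl⟩)
  convert ((h l).compl).inter ((h (-l)).compl) using 1
  ext x
  simp [le_antisymm_iff]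

/-- The kernel of a linear map to a finite-dimensional space is semi-algebraic. -/
theorem isSemialgebraic_ker {Y : Type*} [AddCommGroup Y] [Module ℝ Y] [FiniteDimensional ℝ Y]
    (T : X →ₗ[ℝ] Y) : IsSemialgebraic {x | T x = 0} := by
  let b := Module.finBasis ℝ Y
  have : {x | T x = 0} = ⋂ i, {x | (b.coord i ∘ₗ T) x = 0} := by
    ext x
    simp [← b.forall_coord_eq_zero_iff]
  rw [this]
  exact IsSemialgebraic.finite_iInter fun i => isSemialgebraic_linear_eq_zero _

end Semialgebraic

namespace IOLinkage

variable {ι κ τ ρ : Type} {A : IOLinkage (τ ⊕ ρ) κ} {B : IOLinkage ι τ}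
variable {𝕜 : Type} [RCLike 𝕜]
variable {c : FunctionClass} {GA : Subgroup (Equiv.Perm A.config)}
  {GB : Subgroup (Equiv.Perm B.config)} {f : (τ ⊕ ρ → ℂ) → κ → ℂ} {g : (ι → 𝕜) → τ → ℂ}

/-- The homeomorphism is the restriction of a real linear map, so its graph is the trace of a linear
subspace and no semi-algebraicity of `g` is involved. -/
theorem isSemialgebraicIso_domHomeomorph [Fintype ι] [Fintype τ] [Fintype ρ]
    (hρ : ρ → (RCLike.I : 𝕜) ≠ 0) (hB : B.ComputesWithGroup 𝕜 c GB g) :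
    IsSemialgebraicIso (domHomeomorph (A := A) hρ hB) := by
  let T₁ : (τ ⊕ ρ → ℂ) × (ι → 𝕜) →ₗ[ℝ] (ι ⊕ ρ → 𝕜) := LinearMap.pi (Sum.elim
    (fun i => LinearMap.proj i ∘ₗ LinearMap.snd ℝ _ _)
    fun r => (RCLike.map ℂ 𝕜 : ℂ →ₗ[ℝ] 𝕜) ∘ₗ LinearMap.proj (Sum.inr r) ∘ₗ LinearMap.fst ℝ _ _)
  have hT : ∀ z, T₁ z = Sum.elim z.2 fun r => RCLike.map ℂ 𝕜 (z.1 (Sum.inr r)) := fun z => by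
    funext x
    cases x <;> rfl
  refine ⟨_, isSemialgebraic_ker (T₁ ∘ₗ LinearMap.fst ℝ _ _ - LinearMap.snd ℝ _ _), fun z w => ?_⟩
  change _ ↔ T₁ z.1 - w.1 = 0
  rw [sub_eq_zero, hT, Subtype.ext_iff]
  rfl

/-- The action of pairs of symmetries on the composition. -/
theorem exists_symmetryHom (hA : A.ComputesWithGroup ℂ c GA f)
    (hB : B.ComputesWithGroup 𝕜 c GB g) :
    ∃ Φ : GA × GB →* Equiv.Perm (A.comp B).config, ∀ s φ,
      resA A B (Φ s φ) = s.1.1 (resA A B φ) ∧ resB A B (Φ s φ) = s.2.1 (resB A B φ) := by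
  have hex : ∀ (s : GA × GB) (φ : (A.comp B).config), ∃ η : (A.comp B).config,
      resA A B η = s.1.1 (resA A B φ) ∧ resB A B η = s.2.1 (resB A B φ) := fun s φ =>
    exists_comp_config A B _ _ fun t => by
      rw [hA.input_perm s.1.2, resA_input, hB.output_perm s.2.2]
  choose F hFA hFB using hex
  -- A realization is determined by its restrictions, so the group laws can be checked on `A` and
  -- `B` separately.
  have hone : ∀ φ, F 1 φ = φ := fun φ =>
    comp_config_ext A B ((hFA 1 φ).trans rfl) ((hFB 1 φ).trans rfl)
  have hmul : ∀ s t φ, F (s * t) φ = F s (F t φ) := fun s t φ => by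
    refine comp_config_ext A B ?_ ?_
    · rw [hFA, hFA, hFA]
      rfl
    · rw [hFB, hFB, hFB]
      rfl
  exact ⟨
    { toFun := fun s => ⟨F s, F s⁻¹, fun φ => by rw [← hmul, inv_mul_cancel, hone],
        fun φ => by rw [← hmul, mul_inv_cancel, hone]⟩
      map_one' := Equiv.ext hone
      map_mul' := fun s t => Equiv.ext (hmul s t) }, fun s φ => ⟨hFA s φ, hFB s φ⟩⟩

/-! ### Symmetries and walls of a composition -/

section Symmetry

variable {Φ : GA × GB →* Equiv.Perm (A.comp B).config}
  (hΦ : ∀ s φ, resA A B (Φ s φ) = s.1.1 (resA A B φ) ∧ resB A B (Φ s φ) = s.2.1 (resB A B φ))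
include hΦ

theorem mem_range_symmetryHom (σ : Equiv.Perm (A.comp B).config) :
    σ ∈ Φ.range ↔ ∃ σ' ∈ GA, ∃ σ'' ∈ GB, ∀ φ, resA A B (σ φ) = σ' (resA A B φ) ∧
      resB A B (σ φ) = σ'' (resB A B φ) := by
  constructor
  · rintro ⟨s, rfl⟩
    exact ⟨_, s.1.2, _, s.2.2, hΦ s⟩
  · rintro ⟨σ', h', σ'', h'', h⟩
    refine ⟨(⟨σ', h'⟩, ⟨σ'', h''⟩), Equiv.ext fun φ => comp_config_ext A B ?_ ?_⟩
    · rw [(h φ).1, (hΦ _ φ).1]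
    · rw [(h φ).2, (hΦ _ φ).2]

theorem wall_comp_subset : (A.comp B).wall Φ.range ⊆
    {φ | resA A B φ ∈ A.wall GA} ∪ {φ | resB A B φ ∈ B.wall GB} := by
  rintro φ ⟨_, ⟨s, rfl⟩, hs, hφ⟩
  by_cases h1 : s.1 = 1
  · refine Or.inr ⟨s.2.1, s.2.2, fun h2 => hs ?_, ?_⟩
    · rw [show s = 1 from Prod.ext h1 (Subtype.ext h2), map_one]
    · rw [← (hΦ s φ).2, hφ]
  · refine Or.inl ⟨s.1.1, s.1.2, fun h2 => h1 (Subtype.ext h2), ?_⟩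
    rw [← (hΦ s φ).1, hφ]

/-- If a pair acts trivially, each component fixes the restriction of `φ`, which lies off the wall,
so each component is trivial. -/
theorem symmetryHom_injective (h : ∃ φ : (A.comp B).config, resA A B φ ∉ A.wall GA ∧
    resB A B φ ∉ B.wall GB) : Function.Injective Φ := by
  obtain ⟨φ, hφA, hφB⟩ := h
  refine (injective_iff_map_eq_one Φ).2 fun s hs => ?_
  have hφ := hΦ s φ
  rw [hs] at hφ
  refine Prod.ext (Subtype.ext ?_) (Subtype.ext ?_)
  · by_contra hne
    exact hφA ⟨s.1.1, s.1.2, hne, hφ.1.symm⟩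
  · by_contra hne
    exact hφB ⟨s.2.1, s.2.2, hne, hφ.2.symm⟩

/-- A symmetry of one linkage is padded by the identity on the other; injectivity keeps the
resulting pair from acting trivially. -/
theorem wall_comp_of_injective (h : Function.Injective Φ) : (A.comp B).wall Φ.range =
    {φ | resA A B φ ∈ A.wall GA} ∪ {φ | resB A B φ ∈ B.wall GB} := by
  refine (wall_comp_subset hΦ).antisymm ?_
  rintro φ (⟨σ, hσ, hne, hfix⟩ | ⟨σ, hσ, hne, hfix⟩)
  · refine ⟨Φ (⟨σ, hσ⟩, 1), ⟨_, rfl⟩, fun h1 => hne ?_, comp_config_ext A B ?_ ?_⟩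
    · have := (injective_iff_map_eq_one Φ).1 h _ h1
      exact congrArg Subtype.val (congrArg Prod.fst this)
    · rw [(hΦ _ φ).1, hfix]
    · exact (hΦ _ φ).2
  · refine ⟨Φ (1, ⟨σ, hσ⟩), ⟨_, rfl⟩, fun h1 => hne ?_, comp_config_ext A B ?_ ?_⟩
    · have := (injective_iff_map_eq_one Φ).1 h _ h1
      exact congrArg Subtype.val (congrArg Prod.snd this)
    · exact (hΦ _ φ).1
    · rw [(hΦ _ φ).2, hfix]

variable [Fintype ι] [Fintype τ] [Fintype ρ]

/-- The composition computes the composed function. -/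
theorem computesWithGroup_comp (hρ : ρ → (RCLike.I : 𝕜) ≠ 0) (hA : A.ComputesWithGroup ℂ c GA f)
    (hB : B.ComputesWithGroup 𝕜 c GB g)
    (hint : ∃ y ∈ interior (B.dom 𝕜), ∃ x ∈ interior (A.dom ℂ),
      (fun t => x (Sum.inl t)) = g y) :
    (A.comp B).ComputesWithGroup 𝕜 c Φ.range (fun z => f (Sum.elim (g fun i => z (Sum.inl i))
      fun r => RCLike.map 𝕜 ℂ (z (Sum.inr r)))) where
  input_mem φ x := by
    rcases x with i | r
    · exact hB.input_mem (resB A B φ) i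
    · exact RCLike.map_map_complex (hρ r) _
  interior_dom := by
    obtain ⟨y, hy, x, hx, hxy⟩ := hint
    -- Restoring the inputs of `A` through `g` is continuous at `z` and sends `z` to `x`. Points
    -- near `z` therefore give inputs in both domains.
    let z : ι ⊕ ρ → 𝕜 := Sum.elim y fun r => RCLike.map ℂ 𝕜 (x (Sum.inr r))
    have hB' : B.dom 𝕜 ∈ 𝓝 y := mem_interior_iff_mem_nhds.1 hy
    have hA' : A.dom ℂ ∈ 𝓝 x := mem_interior_iff_mem_nhds.1 hx
    have hp : Continuous fun w : ι ⊕ ρ → 𝕜 => fun i => w (Sum.inl i) :=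
      continuous_pi fun i => continuous_apply _
    have hg : ContinuousAt (fun w : ι ⊕ ρ → 𝕜 => g fun i => w (Sum.inl i)) z :=
      ContinuousAt.comp (f := fun w : ι ⊕ ρ → 𝕜 => fun i => w (Sum.inl i))
        (hB.continuousOn_dom.continuousAt hB') hp.continuousAt
    have hq : ContinuousAt (fun w : ι ⊕ ρ → 𝕜 => Sum.elim (g fun i => w (Sum.inl i))
        fun r => RCLike.map 𝕜 ℂ (w (Sum.inr r))) z := by
      refine continuousAt_pi.2 fun s => ?_
      rcases s with t | r
      · exact continuousAt_pi.1 hg t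
      · exact ((RCLike.map 𝕜 ℂ).continuous.comp (continuous_apply _)).continuousAt
    have hqz : (Sum.elim (g fun i => z (Sum.inl i)) fun r => RCLike.map 𝕜 ℂ (z (Sum.inr r))) =
        x := by
      funext s
      rcases s with t | r
      · exact (congrFun hxy t).symm
      · exact RCLike.map_map_complex (hρ r) _
    refine ⟨z, mem_interior_iff_mem_nhds.2 ?_⟩
    have h1 := hp.continuousAt.preimage_mem_nhds (x := z) (t := B.dom 𝕜) hB'
    have h2 := hq.preimage_mem_nhds (t := A.dom ℂ) (by rwa [hqz])
    filter_upwards [h1, h2] with w h1 h2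
    have := mem_comp_dom (A := A) hB ⟨h2, h1, rfl⟩
    convert this using 1
    funext s
    rcases s with i | r
    · rfl
    · exact (RCLike.map_complex_map 𝕜 _).symm
  finite_group := by
    have := hA.finite_group
    have := hB.finite_group
    exact Finite.of_surjective Φ.rangeRestrict Φ.rangeRestrict_surjective
  scheme_aut := by
    rintro _ ⟨s, rfl⟩
    exact isSchemeAut_comp (fun φ => (hΦ s φ).1) (fun φ => (hΦ s φ).2)
      (hA.scheme_aut _ s.1.2) (hB.scheme_aut _ s.2.2)
  fiber_iff φ ψ := by
    constructor
    · intro h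
      have hb : B.inputMap 𝕜 (resB A B φ).1 = B.inputMap 𝕜 (resB A B ψ).1 := by
        funext i
        exact congrFun h (Sum.inl i)
      have ha : A.inputMap ℂ (resA A B φ).1 = A.inputMap ℂ (resA A B ψ).1 := by
        rw [resA_inputMap hρ hB, resA_inputMap hρ hB, h]
      obtain ⟨σ', h', hφ'⟩ := (hA.fiber_iff _ _).1 ha
      obtain ⟨σ'', h'', hφ''⟩ := (hB.fiber_iff _ _).1 hb
      refine ⟨Φ (⟨σ', h'⟩, ⟨σ'', h''⟩), ⟨_, rfl⟩, comp_config_ext A B ?_ ?_⟩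
      · rw [(hΦ _ φ).1, hφ']
      · rw [(hΦ _ φ).2, hφ'']
    · rintro ⟨_, ⟨s, rfl⟩, rfl⟩
      rw [inputMap_comp, inputMap_comp, (hΦ s φ).1, (hΦ s φ).2, hA.inputMap_perm s.1.2,
        hB.inputMap_perm s.2.2]
  isQuotientMap := by
    have : (A.comp B).inputOnto 𝕜 = domHomeomorph hρ hB ∘ compInput hB := by
      funext φ
      exact Subtype.ext (inputMap_comp φ)
    rw [this]
    refine ((domHomeomorph hρ hB).isOpenMap.comp (isOpenMap_compInput hA hB)).isQuotientMap
      ((domHomeomorph hρ hB).continuous.comp (continuous_compInput hB)) ?_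
    rw [← this]
    rintro ⟨_, φ, hφ, rfl⟩
    exact ⟨⟨φ, hφ⟩, rfl⟩
  output_eq φ := by
    rw [← resA_inputMap hρ hB, ← hA.output_eq]
    rfl

/-- Preimages of dense sets under open maps are dense, and the preimage of the good part of the
fiber product misses the closed wall. -/
theorem wall_nowhereDense_comp (hA : A.ComputesWithGroup ℂ c GA f)
    (hB : B.ComputesWithGroup 𝕜 c GB g) (hw : IsClosed ((A.comp B).wall Φ.range))
    (hD : Dense {z : domProduct 𝕜 A B g |
      z.1.1 ∉ A.wallInDom ℂ GA ∧ z.1.2 ∉ B.wallInDom 𝕜 GB}) :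
    IsNowhereDense ((A.comp B).wall Φ.range) := by
  rw [hw.isNowhereDense_iff, interior_eq_empty_iff_dense_compl]
  refine (hD.preimage (isOpenMap_compInput hA hB)).mono fun φ hφ hφw => ?_
  rcases wall_comp_subset hΦ hφw with h | h
  exacts [hφ.1 ⟨_, h, rfl⟩, hφ.2 ⟨_, h, rfl⟩]

end Symmetry

theorem exists_notMem_wall_of_domProduct [Fintype ι] [Fintype τ] [Fintype ρ]
    (hB : B.ComputesWithGroup 𝕜 c GB g)
    (h : ∃ z ∈ domProduct 𝕜 A B g, z.1 ∉ A.wallInDom ℂ GA ∧ z.2 ∉ B.wallInDom 𝕜 GB) :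
    ∃ φ : (A.comp B).config, resA A B φ ∉ A.wall GA ∧ resB A B φ ∉ B.wall GB := by
  obtain ⟨⟨_, _⟩, ⟨⟨φ, hφ, rfl⟩, ⟨ψ, hψ, rfl⟩, h⟩, h1, h2⟩ := h
  obtain ⟨η, h3, h4⟩ := exists_comp_config_of_inputMap (φ := ⟨φ, hφ⟩) (ψ := ⟨ψ, hψ⟩) hB (congrFun h)
  exact ⟨η, fun hw => h1 ⟨_, h3 ▸ hw, rfl⟩, fun hw => h2 ⟨_, h4 ▸ hw, rfl⟩⟩

end IOLinkage

/-! ## Divided differences of analytic functions -/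

section DividedDifference

variable {E F : Type*} [NormedAddCommGroup E] [NormedSpace ℝ E] [NormedAddCommGroup F]
  [NormedSpace ℝ F]

theorem ContinuousMultilinearMap.norm_compContinuousLinearMap_le_of_norm_le_one {E' : Type*}
    [NormedAddCommGroup E'] [NormedSpace ℝ E'] {n : ℕ} (g : E [×n]→L[ℝ] F)
    {T : Fin n → E' →L[ℝ] E} (hT : ∀ i, ‖T i‖ ≤ 1) : ‖g.compContinuousLinearMap T‖ ≤ ‖g‖ :=
  (g.norm_compContinuousLinearMap_le T).trans (mul_le_of_le_one_right (norm_nonneg _)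
    (Finset.prod_le_one (fun _ _ => norm_nonneg _) fun i _ => hT i))

/-- A homogeneous part of the divided difference of a power series. -/
def FormalMultilinearSeries.dividedDifferenceTerm (p : FormalMultilinearSeries ℝ E F) (n : ℕ)
    (k : Fin (n + 1)) : (E × E) [×n]→L[ℝ] (E →L[ℝ] F) :=
  (ContinuousLinearMap.flipMultilinear ((p (n + 1)).curryMid k)).compContinuousLinearMap
    fun i => if i.castSucc < k then ContinuousLinearMap.fst ℝ E E
      else ContinuousLinearMap.snd ℝ E E

/-- The divided difference of a power series. -/
def FormalMultilinearSeries.dividedDifference (p : FormalMultilinearSeries ℝ E F) :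
    FormalMultilinearSeries ℝ (E × E) (E →L[ℝ] F) :=
  fun n => ∑ k, p.dividedDifferenceTerm n k

namespace FormalMultilinearSeries

variable (p : FormalMultilinearSeries ℝ E F)

theorem dividedDifferenceTerm_apply (n : ℕ) (k : Fin (n + 1)) (u w h : E) :
    p.dividedDifferenceTerm n k (fun _ => (u, w)) h =
      p (n + 1) (Function.update (fun i => if i < k then u else w) k h) := by
  change p (n + 1) (k.insertNth h _) = _
  congr 1
  rw [Fin.insertNth_eq_iff]
  refine ⟨by simp, funext fun i => ?_⟩
  simp only [Fin.removeNth, Function.update_of_ne (Fin.succAbove_ne k i),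
    Fin.succAbove_lt_iff_castSucc_lt]
  split_ifs <;> rfl

/-- Replacing the arguments `w` by `u` one slot at a time gives a telescoping sum; `v j` has `u` in
the first `j` slots, and the term `k` accounts for the change in slot `k`. -/
theorem dividedDifference_apply (n : ℕ) (u w : E) :
    p.dividedDifference n (fun _ => (u, w)) (u - w) =
      p (n + 1) (fun _ => u) - p (n + 1) fun _ => w := by
  let v : ℕ → Fin (n + 1) → E := fun j i => if (i : ℕ) < j then u else w
  have hstep : ∀ k : Fin (n + 1), p.dividedDifferenceTerm n k (fun _ => (u, w)) (u - w) =
      p (n + 1) (v (k + 1)) - p (n + 1) (v k) := fun k => by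
    rw [dividedDifferenceTerm_apply, ContinuousMultilinearMap.map_update_sub]
    congr 2 <;> funext i
    · rcases eq_or_ne i k with rfl | hne
      · simp [v]
      · have : (i : ℕ) ≠ k := fun h => hne (Fin.ext h)
        rw [Function.update_of_ne hne]
        exact if_congr (by rw [Fin.lt_def]; omega) rfl rfl
    · rcases eq_or_ne i k with rfl | hne
      · simp [v]
      · rw [Function.update_of_ne hne]
        rfl
  rw [dividedDifference, sum_apply, sum_apply,
    Finset.sum_congr rfl fun k _ => hstep k,
    Fin.sum_univ_eq_sum_range (fun k => p (n + 1) (v (k + 1)) - p (n + 1) (v k)) (n + 1),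
    Finset.sum_range_sub fun k => p (n + 1) (v k)]
  congr 2
  funext i
  exact if_pos i.2

theorem norm_dividedDifferenceTerm_le (n : ℕ) (k : Fin (n + 1)) :
    ‖p.dividedDifferenceTerm n k‖ ≤ ‖p (n + 1)‖ := by
  let g : E [×n]→L[ℝ] (E →L[ℝ] F) :=
    ContinuousLinearMap.flipMultilinear ((p (n + 1)).curryMid k)
  have h1 : ‖g‖ ≤ ‖p (n + 1)‖ :=
    (MultilinearMap.mkContinuous_norm_le _ (norm_nonneg _) _).trans_eq
      (ContinuousMultilinearMap.norm_curryMid k (p (n + 1)))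
  refine le_trans ?_ h1
  change ‖g.compContinuousLinearMap _‖ ≤ _
  exact g.norm_compContinuousLinearMap_le_of_norm_le_one fun i => by
    split
    exacts [ContinuousLinearMap.norm_fst_le _ _ _, ContinuousLinearMap.norm_snd_le _ _ _]

theorem norm_dividedDifference_le (n : ℕ) :
    ‖p.dividedDifference n‖ ≤ (n + 1) * ‖p (n + 1)‖ := by
  have h : ‖∑ k, p.dividedDifferenceTerm n k‖ ≤ ∑ k, ‖p.dividedDifferenceTerm n k‖ :=
    norm_sum_le (E := (E × E) [×n]→L[ℝ] (E →L[ℝ] F)) Finset.univ fun k =>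
      p.dividedDifferenceTerm n k
  refine h.trans ((Finset.sum_le_sum fun k _ => p.norm_dividedDifferenceTerm_le n k).trans ?_)
  simp

theorem radius_dividedDifference_pos (hp : 0 < p.radius) : 0 < p.dividedDifference.radius := by
  obtain ⟨r, hr0, hr⟩ := ENNReal.lt_iff_exists_nnreal_btwn.1 hp
  obtain ⟨C, hC, hpC⟩ := p.norm_mul_pow_le_of_lt_radius hr
  have hr0' : (0 : ℝ) < r := by exact_mod_cast hr0
  -- Halving the radius absorbs the factor `n + 1 ≤ 2 ^ n` from the number of terms; the quotient `C
  -- / r` comes from the shift of degree by one.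
  refine lt_of_lt_of_le ?_ (p.dividedDifference.le_radius_of_bound (C / r) (r := r / 2)
    fun n => ?_)
  · exact_mod_cast half_pos hr0'
  · have h2 : ((n : ℝ) + 1) ≤ 2 ^ n := by exact_mod_cast Nat.lt_two_pow_self
    have h3 := hpC (n + 1)
    have h4 := norm_nonneg (p (n + 1))
    calc ‖p.dividedDifference n‖ * ((r / 2 : NNReal) : ℝ) ^ n
        ≤ ((n + 1) * ‖p (n + 1)‖) * ((r / 2 : NNReal) : ℝ) ^ n := by
          gcongr
          exact p.norm_dividedDifference_le n
      _ ≤ (2 ^ n * ‖p (n + 1)‖) * ((r / 2 : NNReal) : ℝ) ^ n := by gcongr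
      _ = ‖p (n + 1)‖ * (r : ℝ) ^ (n + 1) / r := by
          push_cast
          rw [div_pow]
          field_simp
          ring
      _ ≤ C / r := by gcongr

end FormalMultilinearSeries

/-- Hadamard's lemma for analytic functions. -/
theorem AnalyticAt.exists_dividedDifference [CompleteSpace F] {f : E → F} {x : E}
    (hf : AnalyticAt ℝ f x) : ∃ G : E × E → E →L[ℝ] F, AnalyticAt ℝ G (x, x) ∧
      ∀ᶠ z in 𝓝 (x, x), f z.1 - f z.2 = G z (z.1 - z.2) := by
  obtain ⟨p, hp⟩ := hf
  have hq := p.dividedDifference.hasFPowerSeriesOnBall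
    (p.radius_dividedDifference_pos hp.radius_pos)
  have hq' : HasFPowerSeriesAt (fun z : E × E => p.dividedDifference.sum (z - (x, x)))
      p.dividedDifference (x, x) := by
    simpa using (hq.comp_sub (x, x)).hasFPowerSeriesAt
  refine ⟨_, hq'.analyticAt, ?_⟩
  have h1 := hp.eventually_hasSum_sub
  have hfst : Tendsto (Prod.fst : E × E → E) (𝓝 (x, x)) (𝓝 x) := continuous_fst.tendsto _
  have hsnd : Tendsto (Prod.snd : E × E → E) (𝓝 (x, x)) (𝓝 x) := continuous_snd.tendsto _
  filter_upwards [hfst.eventually h1, hsnd.eventually h1, hq'.eventually_hasSum_sub]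
    with z hu hw hG
  have h2 := (hu.sub hw)
  -- Degree `n` of the divided difference comes from degree `n + 1` of `p`; the constant terms of
  -- the two expansions cancel.
  rw [← hasSum_nat_add_iff' 1] at h2
  have h3 := hG.mapL (ContinuousLinearMap.apply ℝ F (z.1 - z.2))
  refine HasSum.unique ?_ h3
  convert h2 using 1
  · funext n
    have := p.dividedDifference_apply n (z.1 - x) (z.2 - x)
    rw [sub_sub_sub_cancel_right] at this
    exact this
  · rw [Finset.sum_range_one, Subsingleton.elim (fun _ : Fin 0 => z.1 - x) fun _ => z.2 - x,
      sub_self, sub_zero]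

end DividedDifference

/-! ## Congruences of analytic germs -/

section Germs

variable {X Y E F : Type*} [NormedAddCommGroup X] [NormedSpace ℝ X] [NormedAddCommGroup Y]
  [NormedSpace ℝ Y] [NormedAddCommGroup E] [NormedSpace ℝ E] [NormedAddCommGroup F]
  [NormedSpace ℝ F]

/-- The germ of a function belongs to an ideal of analytic germs. -/
def GermMem {x : X} (I : Ideal (analyticGerms x)) (h : X → ℝ) : Prop :=
  ∃ d ∈ I, (d : Germ (𝓝 x) ℝ) = (h : Germ (𝓝 x) ℝ)

namespace GermMem

variable {x : X} {I : Ideal (analyticGerms x)} {h k : X → ℝ}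

theorem congr (hh : GermMem I h) (hk : h =ᶠ[𝓝 x] k) : GermMem I k := by
  obtain ⟨d, hd, he⟩ := hh
  exact ⟨d, hd, he.trans (Germ.coe_eq.2 hk)⟩

theorem zero : GermMem I 0 := ⟨0, I.zero_mem, rfl⟩

theorem add (hh : GermMem I h) (hk : GermMem I k) : GermMem I (h + k) := by
  obtain ⟨d, hd, hd'⟩ := hh
  obtain ⟨e, he, he'⟩ := hk
  refine ⟨d + e, I.add_mem hd he, ?_⟩
  rw [Germ.coe_add, ← hd', ← he']
  rfl

theorem mul_left (hk : GermMem I k) (hh : AnalyticAt ℝ h x) : GermMem I (h * k) := by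
  obtain ⟨e, he, he'⟩ := hk
  refine ⟨⟨h, h, hh, rfl⟩ * e, I.mul_mem_left _ he, ?_⟩
  rw [Germ.coe_mul, ← he']
  rfl

theorem neg (hk : GermMem I k) : GermMem I (-k) := by
  obtain ⟨e, he, he'⟩ := hk
  refine ⟨-e, I.neg_mem he, ?_⟩
  rw [Germ.coe_neg, ← he']
  rfl

theorem sum {J : Type*} (s : Finset J) {h : J → X → ℝ} (hh : ∀ j ∈ s, GermMem I (h j)) :
    GermMem I (∑ j ∈ s, h j) :=
  Finset.sum_induction h (GermMem I) (fun _ _ => add) zero hh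

end GermMem

/-- Two maps to a normed space are congruent modulo an ideal of analytic germs. -/
def GermCongr {x : X} (I : Ideal (analyticGerms x)) (u w : X → E) : Prop :=
  ∀ l : E →L[ℝ] ℝ, GermMem I fun y => l (u y) - l (w y)

namespace GermCongr

variable {x : X} {I : Ideal (analyticGerms x)} {u v w : X → E}

theorem of_eventuallyEq (h : u =ᶠ[𝓝 x] v) : GermCongr I u v := fun l =>
  GermMem.zero.congr (by
    filter_upwards [h] with y hy
    rw [hy, sub_self]
    rfl)

theorem trans (h : GermCongr I u v) (h' : GermCongr I v w) : GermCongr I u w := fun l =>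
  ((h l).add (h' l)).congr (Eventually.of_forall fun _ => sub_add_sub_cancel _ _ _)

theorem clm_comp (h : GermCongr I u v) (T : E →L[ℝ] F) :
    GermCongr I (fun y => T (u y)) fun y => T (v y) := fun l => h (l.comp T)

/-- A functional on a finite product is the sum of its restrictions to the factors. -/
theorem pi {J : Type*} [Fintype J] {E : J → Type*} [∀ j, NormedAddCommGroup (E j)]
    [∀ j, NormedSpace ℝ (E j)] {u v : X → ∀ j, E j}
    (h : ∀ j, GermCongr I (fun y => u y j) fun y => v y j) : GermCongr I u v := fun l => by
  classical
  refine (GermMem.sum Finset.univ fun j _ =>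
    h j (l.comp (ContinuousLinearMap.single ℝ E j))).congr (Eventually.of_forall fun y => ?_)
  rw [Finset.sum_apply, Finset.sum_sub_distrib]
  simp only [ContinuousLinearMap.comp_apply, ContinuousLinearMap.single_apply]
  rw [← map_sum, ← map_sum, Finset.univ_sum_single, Finset.univ_sum_single]

theorem complex {u v : X → ℂ} (hre : GermMem I fun y => (u y).re - (v y).re)
    (him : GermMem I fun y => (u y).im - (v y).im) : GermCongr I u v := fun l =>
  ((hre.mul_left (h := fun _ => l 1) analyticAt_const).add
    (him.mul_left (h := fun _ => l Complex.I) analyticAt_const)).congr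
    (Eventually.of_forall fun y => by
      have hl : ∀ z : ℂ, l z = l 1 * z.re + l Complex.I * z.im := fun z => by
        have hz : z = z.re • (1 : ℂ) + z.im • Complex.I := by
          simp [Complex.re_add_im]
        conv_lhs => rw [hz, map_add, map_smul, map_smul]
        rw [smul_eq_mul, smul_eq_mul, mul_comm, mul_comm z.im]
      change l 1 * ((u y).re - (v y).re) + l Complex.I * ((u y).im - (v y).im) =
        l (u y) - l (v y)
      rw [hl (u y), hl (v y)]
      ring)

/-- Congruences are preserved by analytic maps. -/
theorem analyticAt_comp [FiniteDimensional ℝ E] [CompleteSpace F] (h : GermCongr I u v)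
    (hu : AnalyticAt ℝ u x) (hv : AnalyticAt ℝ v x) (huv : v x = u x) {f : E → F}
    (hf : AnalyticAt ℝ f (u x)) : GermCongr I (fun y => f (u y)) fun y => f (v y) := fun l => by
  -- Expanding `G (u, v) (u - v)` in a basis writes the difference as a combination of the
  -- coordinates of `u - v`, which lie in the ideal, with analytic coefficients.
  obtain ⟨G, hG, hfG⟩ := ((l.analyticAt _).comp hf).exists_dividedDifference
  let b := Module.finBasis ℝ E
  let e : Fin (Module.finrank ℝ E) → E →L[ℝ] ℝ := fun j => (b.coord j).toContinuousLinearMap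
  have huv' : AnalyticAt ℝ (fun y => (u y, v y)) x := hu.prod hv
  have hGuv : AnalyticAt ℝ (fun y => G (u y, v y)) x :=
    AnalyticAt.fun_comp (f := fun y => (u y, v y)) (by rwa [huv]) huv'
  have htend : Tendsto (fun y => (u y, v y)) (𝓝 x) (𝓝 (u x, u x)) := by
    have := huv'.continuousAt.tendsto
    rwa [huv] at this
  refine (GermMem.sum Finset.univ fun j _ => (h (e j)).mul_left
    (h := fun y => G (u y, v y) (b j)) ?_).congr ?_
  · exact ((ContinuousLinearMap.apply ℝ ℝ (b j)).analyticAt _).comp hGuv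
  · filter_upwards [htend.eventually hfG] with y hy
    simp only [Function.comp_apply] at hy
    rw [hy, Finset.sum_apply]
    conv_rhs => rw [← b.sum_repr (u y - v y), map_sum]
    refine Finset.sum_congr rfl fun j _ => ?_
    rw [map_smul, smul_eq_mul, mul_comm, map_sub]
    rfl

end GermCongr

theorem eventuallyEq_of_clm {X : Type*} [TopologicalSpace X] [FiniteDimensional ℝ E] {x : X}
    {u v : X → E}
    (h : ∀ l : E →L[ℝ] ℝ, ∀ᶠ y in 𝓝 x, l (u y) = l (v y)) : u =ᶠ[𝓝 x] v := by
  let b := Module.finBasis ℝ E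
  filter_upwards [eventually_all.2 fun j => h (b.coord j).toContinuousLinearMap] with y hy
  exact b.ext_elem hy

/-- The pull-back of analytic germs along a continuous linear map as a homomorphism. -/
def pullbackGermHom (T : X →L[ℝ] Y) (x : X) : analyticGerms (T x) →+* analyticGerms x where
  toFun := pullbackGerm T x
  map_one' := rfl
  map_zero' := rfl
  map_add' := by
    rintro ⟨_, f, hf, rfl⟩ ⟨_, g, hg, rfl⟩
    rfl
  map_mul' := by
    rintro ⟨_, f, hf, rfl⟩ ⟨_, g, hg, rfl⟩
    rfl

theorem GermMem.pullback {T : X →L[ℝ] Y} {x : X} {I : Ideal (analyticGerms (T x))}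
    {J : Ideal (analyticGerms x)} (hIJ : I ≤ J.comap (pullbackGermHom T x)) {h : Y → ℝ}
    (hh : GermMem I h) : GermMem J fun y => h (T y) := by
  obtain ⟨d, hd, he⟩ := hh
  refine ⟨pullbackGermHom T x d, hIJ hd, ?_⟩
  change (d : Germ (𝓝 (T x)) ℝ).compTendsto T T.continuous.continuousAt = _
  rw [he]
  rfl

theorem GermCongr.pullback {T : X →L[ℝ] Y} {x : X} {I : Ideal (analyticGerms (T x))}
    {J : Ideal (analyticGerms x)} (hIJ : I ≤ J.comap (pullbackGermHom T x)) {u v : Y → E}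
    (h : GermCongr I u v) : GermCongr J (fun y => u (T y)) fun y => v (T y) := fun l =>
  (h l).pullback hIJ

end Germs

/-! ## Stalks of the analytic structure sheaf -/

namespace MarkedLinkage

theorem planeCoord_analyticAt {X : Type*} [NormedAddCommGroup X] [NormedSpace ℝ X] {x : X}
    {u : X → ℂ} (hu : AnalyticAt ℝ u x) (j : Fin 2) :
    AnalyticAt ℝ (fun y => planeCoord (u y) j) x := by
  unfold planeCoord
  split
  exacts [(Complex.reCLM.analyticAt _).comp hu, (Complex.imCLM.analyticAt _).comp hu]

variable (L : MarkedLinkage)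

theorem analyticAt_evalPoly (f : L.Poly) (φ : L.V → ℂ) :
    AnalyticAt ℝ (fun ψ => L.evalPoly ψ f) φ :=
  AnalyticAt.aeval_mvPolynomial (f := fun (ψ : L.V → ℂ) (c : L.V × Fin 2) =>
    planeCoord (ψ c.1) c.2) (fun c => planeCoord_analyticAt (u := fun ψ : L.V → ℂ => ψ c.1)
      ((ContinuousLinearMap.proj (R := ℝ) (φ := fun _ : L.V => ℂ) c.1).analyticAt φ) c.2) f

theorem germMem_stalkIdeal {f : L.Poly} (hf : f ∈ L.ideal) (φ : L.V → ℂ) :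
    GermMem (L.stalkIdeal φ) fun ψ => L.evalPoly ψ f :=
  ⟨⟨_, _, L.analyticAt_evalPoly f φ, rfl⟩, Ideal.subset_span ⟨f, hf, rfl⟩, rfl⟩

/-- Germs in the stalk of the ideal sheaf vanish along families of realizations. -/
theorem eventually_eq_zero_of_germMem {Y : Type*} [TopologicalSpace Y] {y : Y}
    {s : Y → L.V → ℂ} (hs : ContinuousAt s y) (hsc : ∀ᶠ z in 𝓝 y, s z ∈ L.config)
    {h : (L.V → ℂ) → ℝ} (hh : GermMem (L.stalkIdeal (s y)) h) : ∀ᶠ z in 𝓝 y, h (s z) = 0 := by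
  obtain ⟨d, hd, he⟩ := hh
  induction hd using Submodule.span_induction generalizing h with
  | mem d hd =>
    obtain ⟨f, hf, hd⟩ := hd
    have := hs.tendsto.eventually (Germ.coe_eq.1 (he.symm.trans hd))
    filter_upwards [this, hsc] with z hz hz'
    rw [hz]
    exact (L.mem_config_iff _).1 hz' f hf
  | zero => exact hs.tendsto.eventually (Germ.coe_eq.1 he.symm)
  | add d e _ _ ihd ihe =>
    obtain ⟨_, u, hu, rfl⟩ := d
    obtain ⟨_, v, hv, rfl⟩ := e
    have := hs.tendsto.eventually (Germ.coe_eq.1 he.symm)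
    filter_upwards [this, ihd rfl, ihe rfl] with z hz hzu hzv
    rw [hz]
    change u (s z) + v (s z) = 0
    rw [hzu, hzv, add_zero]
  | smul d e _ ih =>
    obtain ⟨_, u, hu, rfl⟩ := d
    obtain ⟨_, v, hv, rfl⟩ := e
    have := hs.tendsto.eventually (Germ.coe_eq.1 he.symm)
    filter_upwards [this, ih rfl] with z hz hzv
    rw [hz]
    change u (s z) * v (s z) = 0
    rw [hzv, mul_zero]

/-- A family of maps on the vertices on which the equations vanish consists of realizations. -/
theorem eventually_mem_config {Y : Type*} [TopologicalSpace Y] {y : Y} {s : Y → L.V → ℂ}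
    (h : ∀ f ∈ L.ideal, ∀ᶠ z in 𝓝 y, L.evalPoly (s z) f = 0) : ∀ᶠ z in 𝓝 y, s z ∈ L.config := by
  -- Each equation vanishes on a neighborhood of its own; finitely many generators allow a common
  -- one.
  obtain ⟨S, hS⟩ := (isNoetherianRing_iff_ideal_fg L.Poly).1 inferInstance L.ideal
  have h' : ∀ᶠ z in 𝓝 y, ∀ f ∈ S, L.evalPoly (s z) f = 0 :=
    (Filter.eventually_all_finset S).2 fun f hf => h f (hS ▸ Ideal.subset_span hf)
  filter_upwards [h'] with z hz
  rw [mem_config_iff]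
  have : L.ideal ≤ RingHom.ker (L.evalPoly (s z)) := by
    rw [← hS]
    exact Ideal.span_le.2 hz
  exact fun f hf => this hf

end MarkedLinkage

namespace IOLinkage

open MarkedLinkage

variable {ι κ τ ρ : Type} {𝕜 : Type} [RCLike 𝕜] [Fintype ι]

/-- The two clauses are injectivity and surjectivity on stalks, with germs replaced by
representatives. -/
theorem isRegularAt_iff_germMem (L : IOLinkage ι κ) (φ : L.V → ℂ) : L.IsRegularAt 𝕜 φ ↔
    (∀ f f' : (ι → 𝕜) → ℝ, AnalyticAt ℝ f (L.inputMap 𝕜 φ) → AnalyticAt ℝ f' (L.inputMap 𝕜 φ) →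
      GermMem (L.stalkIdeal φ) (fun ψ => f (L.inputMap 𝕜 ψ) - f' (L.inputMap 𝕜 ψ)) →
        f =ᶠ[𝓝 (L.inputMap 𝕜 φ)] f') ∧
    ∀ h : (L.V → ℂ) → ℝ, AnalyticAt ℝ h φ → ∃ f : (ι → 𝕜) → ℝ,
      AnalyticAt ℝ f (L.inputMap 𝕜 φ) ∧
        GermMem (L.stalkIdeal φ) fun ψ => h ψ - f (L.inputMap 𝕜 ψ) := by
  have key : ∀ (d : analyticGerms φ) (h : (L.V → ℂ) → ℝ),
      (d : Germ (𝓝 φ) ℝ) = (h : Germ (𝓝 φ) ℝ) →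
        (GermMem (L.stalkIdeal φ) h ↔ d ∈ L.stalkIdeal φ) := fun d h hd =>
    ⟨fun ⟨e, he, heh⟩ => Subtype.ext (heh.trans hd.symm) ▸ he, fun he => ⟨d, he, hd⟩⟩
  refine and_congr ⟨fun H f f' hf hf' hm => ?_, fun H => ?_⟩ ⟨fun H h hh => ?_, fun H => ?_⟩
  · have := @H ⟨f, f, hf, rfl⟩ ⟨f', f', hf', rfl⟩
      (Ideal.Quotient.eq.2 ((key _ _ rfl).1 hm))
    exact Germ.coe_eq.1 (congrArg Subtype.val this)
  · rintro ⟨_, f, hf, rfl⟩ ⟨_, f', hf', rfl⟩ he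
    refine Subtype.ext (Germ.coe_eq.2 (H f f' hf hf' ?_))
    exact (key _ _ rfl).2 (Ideal.Quotient.eq.1 he)
  · obtain ⟨⟨_, f, hf, rfl⟩, he⟩ := H (Ideal.Quotient.mk _ ⟨h, h, hh, rfl⟩)
    exact ⟨f, hf, (key _ _ rfl).2 (Ideal.Quotient.eq.1 he.symm)⟩
  · intro q
    obtain ⟨⟨_, h, hh, rfl⟩, rfl⟩ := Ideal.Quotient.mk_surjective q
    obtain ⟨f, hf, hm⟩ := H h hh
    exact ⟨⟨f, f, hf, rfl⟩, (Ideal.Quotient.eq.2 ((key _ _ rfl).1 hm)).symm⟩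

/-- A realization is regular if and only if the input map has there an analytic section in the
configuration space to which the configuration scheme reduces locally. -/
theorem isRegularAt_iff_exists_section (L : IOLinkage ι κ) {φ : L.V → ℂ} (hφ : φ ∈ L.config) :
    L.IsRegularAt 𝕜 φ ↔ ∃ s : (ι → 𝕜) → L.V → ℂ, AnalyticAt ℝ s (L.inputMap 𝕜 φ) ∧
      s (L.inputMap 𝕜 φ) = φ ∧ (∀ᶠ y in 𝓝 (L.inputMap 𝕜 φ), L.inputMap 𝕜 (s y) = y) ∧
      (∀ᶠ y in 𝓝 (L.inputMap 𝕜 φ), s y ∈ L.config) ∧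
      GermCongr (L.stalkIdeal φ) (fun ψ => ψ) fun ψ => s (L.inputMap 𝕜 ψ) := by
  rw [isRegularAt_iff_germMem]
  constructor
  · rintro ⟨hinj, hsurj⟩
    have hv : ∀ v : L.V, AnalyticAt ℝ (fun ψ : L.V → ℂ => ψ v) φ := fun v =>
      (ContinuousLinearMap.proj (R := ℝ) (φ := fun _ : L.V => ℂ) v).analyticAt φ
    -- Surjectivity expresses each coordinate of a vertex, modulo the ideal, as an analytic function
    -- of the inputs. These functions are the components of the section.
    choose f hf hfm using fun v => hsurj _ ((Complex.reCLM.analyticAt _).comp (hv v))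
    choose g hg hgm using fun v => hsurj _ ((Complex.imCLM.analyticAt _).comp (hv v))
    let s : (ι → 𝕜) → L.V → ℂ := fun y v => f v y + g v y * Complex.I
    have hs : AnalyticAt ℝ s (L.inputMap 𝕜 φ) := AnalyticAt.pi fun v =>
      ((Complex.ofRealCLM.analyticAt _).comp (hf v)).add
        (((Complex.ofRealCLM.analyticAt _).comp (hg v)).mul analyticAt_const)
    have hcongr : GermCongr (L.stalkIdeal φ) (fun ψ => ψ) fun ψ => s (L.inputMap 𝕜 ψ) :=
      GermCongr.pi fun v => GermCongr.complex
        ((hfm v).congr (Eventually.of_forall fun ψ => by simp [s]))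
        ((hgm v).congr (Eventually.of_forall fun ψ => by simp [s]))
    have hsφ : s (L.inputMap 𝕜 φ) = φ := by
      -- Germs in the ideal vanish along families of realizations. The constant family `φ` yields
      -- the value at `φ`; the base point `0` in `ℝ` is a dummy.
      have := eventuallyEq_of_clm (x := (0 : ℝ)) (u := fun _ => φ)
        (v := fun _ => s (L.inputMap 𝕜 φ)) fun l => by
          filter_upwards [L.eventually_eq_zero_of_germMem (y := (0 : ℝ)) (s := fun _ => φ)
            continuousAt_const (Eventually.of_forall fun _ => hφ) (hcongr l)] with _ h
          exact sub_eq_zero.1 h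
      exact this.self_of_nhds.symm
    have hsp : AnalyticAt ℝ (fun ψ => s (L.inputMap 𝕜 ψ)) φ := hs.comp ((L.inputMap 𝕜).analyticAt φ)
    refine ⟨s, hs, hsφ, ?_, L.eventually_mem_config fun p hp => ?_, hcongr⟩
    -- Pulled back by the input map, `y` and the inputs of `s y` are congruent, so injectivity
    -- identifies them.
    · refine eventuallyEq_of_clm fun l => ?_
      refine (hinj (fun y => l y) (fun y => l (L.inputMap 𝕜 (s y))) (l.analyticAt _)
        ((l.analyticAt _).comp (((L.inputMap 𝕜).analyticAt _).comp hs)) ?_).symm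
      exact hcongr (l.comp (L.inputMap 𝕜))
    -- The equation `p` lies in the ideal and is congruent to its value on the section, so that
    -- value pulls back into the ideal and vanishes by injectivity.
    · refine hinj (fun y => L.evalPoly (s y) p) (fun _ => 0)
        ((L.analyticAt_evalPoly p _).comp hs) analyticAt_const ?_
      have h1 := hcongr.analyticAt_comp analyticAt_id hsp hsφ (L.analyticAt_evalPoly p φ)
        (ContinuousLinearMap.id ℝ ℝ)
      refine ((L.germMem_stalkIdeal hp φ).add h1.neg).congr (Eventually.of_forall fun ψ => ?_)
      change L.evalPoly ψ p + -(L.evalPoly ψ p - L.evalPoly (s (L.inputMap 𝕜 ψ)) p) =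
        L.evalPoly (s (L.inputMap 𝕜 ψ)) p - 0
      ring
  · rintro ⟨s, hs, hsφ, hps, hsc, hcongr⟩
    refine ⟨fun f f' hf hf' hm => ?_, fun h hh => ⟨fun y => h (s y), ?_, ?_⟩⟩
    -- A pulled-back germ in the ideal vanishes along the section, where pulling back has no effect.
    · rw [← hsφ] at hm
      filter_upwards [L.eventually_eq_zero_of_germMem hs.continuousAt hsc (by
        rw [hsφ] at hm ⊢; exact hm), hps] with y hy hy'
      rw [hy'] at hy
      exact sub_eq_zero.1 hy
    · exact AnalyticAt.comp (by rwa [hsφ]) hs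
    · exact hcongr.analyticAt_comp analyticAt_id (hs.comp ((L.inputMap 𝕜).analyticAt φ)) hsφ hh
        (ContinuousLinearMap.id ℝ ℝ)

end IOLinkage

/-! ## Regular realizations of compositions -/

namespace MarkedLinkage

variable (A B : MarkedLinkage) {τ : Type} (a : τ ↪ A.V) (b : τ ↪ B.V)

/-- Restriction of maps on the vertices of the fiber sum to the first linkage. -/
def pullLeft : ((fiberSum A B a b).V → ℂ) →L[ℝ] (A.V → ℂ) :=
  ContinuousLinearMap.pi fun v =>
    ContinuousLinearMap.proj (R := ℝ) (φ := fun _ : GlueV A B a b => ℂ) (glueInl A B a b v)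

/-- Restriction of maps on the vertices of the fiber sum to the second linkage. -/
def pullRight : ((fiberSum A B a b).V → ℂ) →L[ℝ] (B.V → ℂ) :=
  ContinuousLinearMap.pi fun v =>
    ContinuousLinearMap.proj (R := ℝ) (φ := fun _ : GlueV A B a b => ℂ) (glueInr A B a b v)

theorem evalPoly_polyLeft (ψ : (fiberSum A B a b).V → ℂ) (f : A.Poly) :
    (fiberSum A B a b).evalPoly ψ (polyLeft A B a b f) = A.evalPoly (pullLeft A B a b ψ) f := by
  refine (MvPolynomial.aeval_rename _ _ f).trans ?_
  rfl

theorem evalPoly_polyRight (ψ : (fiberSum A B a b).V → ℂ) (f : B.Poly) :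
    (fiberSum A B a b).evalPoly ψ (polyRight A B a b f) = B.evalPoly (pullRight A B a b ψ) f := by
  refine (MvPolynomial.aeval_rename _ _ f).trans ?_
  rfl

theorem stalkIdeal_le_left (φ : (fiberSum A B a b).V → ℂ) :
    A.stalkIdeal (pullLeft A B a b φ) ≤
      ((fiberSum A B a b).stalkIdeal φ).comap (pullbackGermHom (pullLeft A B a b) φ) := by
  refine Ideal.span_le.2 ?_
  rintro d ⟨f, hf, hd⟩
  refine Ideal.subset_span ⟨polyLeft A B a b f, ideal_le_left A B a b hf, ?_⟩
  simp only [evalPoly_polyLeft]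
  change d.1.compTendsto _ (pullLeft A B a b).continuous.continuousAt = _
  rw [hd]
  rfl

theorem stalkIdeal_le_right (φ : (fiberSum A B a b).V → ℂ) :
    B.stalkIdeal (pullRight A B a b φ) ≤
      ((fiberSum A B a b).stalkIdeal φ).comap (pullbackGermHom (pullRight A B a b) φ) := by
  refine Ideal.span_le.2 ?_
  rintro d ⟨f, hf, hd⟩
  refine Ideal.subset_span ⟨polyRight A B a b f, ideal_le_right A B a b hf, ?_⟩
  simp only [evalPoly_polyRight]
  change d.1.compTendsto _ (pullRight A B a b).continuous.continuousAt = _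
  rw [hd]
  rfl

end MarkedLinkage

namespace IOLinkage

open MarkedLinkage

variable {ι κ τ ρ : Type} {A : IOLinkage (τ ⊕ ρ) κ} {B : IOLinkage ι τ}
variable {𝕜 : Type} [RCLike 𝕜] [Fintype ι] [Fintype τ] [Fintype ρ]

/-- Realizations of the composition with regular restrictions are regular. -/
theorem isRegularAt_comp (hρ : ρ → (RCLike.I : 𝕜) ≠ 0) {φ : (A.comp B).config}
    (hA : A.IsRegularAt ℂ (resA A B φ).1) (hB : B.IsRegularAt 𝕜 (resB A B φ).1) :
    (A.comp B).IsRegularAt 𝕜 φ.1 := by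
  obtain ⟨sA, hsA, hsA0, hpA, hcA, hgA⟩ :=
    (A.isRegularAt_iff_exists_section (resA A B φ).2).1 hA
  obtain ⟨sB, hsB, hsB0, hpB, hcB, hgB⟩ :=
    (B.isRegularAt_iff_exists_section (resB A B φ).2).1 hB
  let a : τ ↪ A.V := Function.Embedding.inl.trans A.input
  let z : ι ⊕ ρ → 𝕜 := (A.comp B).inputMap 𝕜 φ.1
  let π : (ι ⊕ ρ → 𝕜) →L[ℝ] (ι → 𝕜) :=
    ContinuousLinearMap.pi fun i => ContinuousLinearMap.proj (Sum.inl i)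
  have hπz : π z = B.inputMap 𝕜 (resB A B φ).1 := rfl
  -- The inputs of `A` as a function of those of the composition. The glued ones are read off the
  -- section of `B` instead of `g`, which makes `q` analytic.
  let q : (ι ⊕ ρ → 𝕜) → (τ ⊕ ρ → ℂ) := fun w =>
    Sum.elim (fun t => sB (π w) (B.output t)) fun r => RCLike.map 𝕜 ℂ (w (Sum.inr r))
  have hsBπ : AnalyticAt ℝ (fun w => sB (π w)) z :=
    AnalyticAt.comp (g := sB) (f := π) (by rw [hπz]; exact hsB) (π.analyticAt z)
  have hq : AnalyticAt ℝ q z := by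
    refine AnalyticAt.pi (Fm := fun _ : τ ⊕ ρ => ℂ) (f := fun x w => q w x) fun x => ?_
    rcases x with t | r
    · exact ((ContinuousLinearMap.proj (R := ℝ) (φ := fun _ : B.V => ℂ)
        (B.output t)).analyticAt _).comp hsBπ
    · exact ((RCLike.map 𝕜 ℂ).comp (ContinuousLinearMap.proj (R := ℝ)
        (φ := fun _ : ι ⊕ ρ => 𝕜) (Sum.inr r))).analyticAt z
  have hqz : q z = A.inputMap ℂ (resA A B φ).1 := by
    funext x
    rw [inputMap_complex_apply]
    rcases x with t | r
    · change sB (π z) (B.output t) = _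
      rw [resA_input, hπz, hsB0]
    · exact RCLike.map_map_complex (hρ r) _
  let s : (ι ⊕ ρ → 𝕜) → (A.comp B).V → ℂ := fun w => glueFun a B.output (sA (q w)) (sB (π w))
  have hsAq : AnalyticAt ℝ (fun w => sA (q w)) z :=
    AnalyticAt.comp (g := sA) (f := q) (by rw [hqz]; exact hsA) hq
  have hs : AnalyticAt ℝ s z := by
    refine AnalyticAt.pi (Fm := fun _ : (A.comp B).V => ℂ) (f := fun x w => s w x) fun v => ?_
    -- With the representative fixed, each component is a coordinate of one of the two sections, so
    -- compatibility is not needed here.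
    change AnalyticAt ℝ (fun w => Sum.elim (sA (q w)) (sB (π w)) (Quot.out v)) z
    cases Quot.out v with
    | inl v => exact ((ContinuousLinearMap.proj (R := ℝ) (φ := fun _ : A.V => ℂ) v).analyticAt
        _).comp hsAq
    | inr v => exact ((ContinuousLinearMap.proj (R := ℝ) (φ := fun _ : B.V => ℂ) v).analyticAt
        _).comp hsBπ
  have hqt : Tendsto q (𝓝 z) (𝓝 (A.inputMap ℂ (resA A B φ).1)) := hqz ▸ hq.continuousAt.tendsto
  have hπt : Tendsto π (𝓝 z) (𝓝 (B.inputMap 𝕜 (resB A B φ).1)) := π.continuous.tendsto z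
  have hcompat : ∀ᶠ w in 𝓝 z, ∀ x, sA (q w) (A.input x) = q w x := by
    filter_upwards [hqt.eventually hpA] with w hw x
    rw [← inputMap_complex_apply A (sA (q w)), hw]
  have hglue : ∀ᶠ w in 𝓝 z, ∀ x, s w (Quot.mk _ x) = Sum.elim (sA (q w)) (sB (π w)) x := by
    filter_upwards [hcompat] with w hw x
    exact glueFun_mk (a := a) (b := B.output) (fun t => hw (Sum.inl t)) x
  rw [isRegularAt_iff_exists_section _ φ.2]
  refine ⟨s, hs, ?_, ?_, ?_, ?_⟩
  · funext v
    obtain ⟨x, rfl⟩ := Quot.exists_rep v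
    refine (hglue.self_of_nhds x).trans ?_
    rw [hqz, hπz, hsA0, hsB0]
    cases x <;> rfl
  · filter_upwards [hglue, hcompat, hπt.eventually hpB] with w hw hw' hB
    funext x
    rcases x with i | r
    · refine Eq.trans ?_ (congrFun hB i)
      exact congrArg (RCLike.map ℂ 𝕜) (hw (Sum.inr (B.input i)))
    · refine Eq.trans ?_ (RCLike.map_complex_map 𝕜 (w (Sum.inr r)))
      refine congrArg (RCLike.map ℂ 𝕜) ((hw (Sum.inl (A.input (Sum.inr r)))).trans ?_)
      exact hw' (Sum.inr r)
  · filter_upwards [hglue, hcompat, hqt.eventually hcA, hπt.eventually hcB] with w hw hw' hA hB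
    obtain ⟨η, hηA, hηB⟩ := exists_comp_config A B ⟨_, hA⟩ ⟨_, hB⟩ fun t => hw' (Sum.inl t)
    convert η.2 using 1
    funext v
    obtain ⟨x, rfl⟩ := Quot.exists_rep v
    refine (hw x).trans ?_
    rcases x with v | v
    · exact congrFun (congrArg Subtype.val hηA).symm v
    · exact congrFun (congrArg Subtype.val hηB).symm v
  · let TA := pullLeft A.toMarkedLinkage B.toMarkedLinkage a B.output
    let TB := pullRight A.toMarkedLinkage B.toMarkedLinkage a B.output
    let p : ((A.comp B).V → ℂ) →L[ℝ] (ι ⊕ ρ → 𝕜) := (A.comp B).inputMap 𝕜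
    have h1 : GermCongr ((A.comp B).stalkIdeal φ.1) (fun ψ => TB ψ) fun ψ => sB (π (p ψ)) :=
      GermCongr.pullback (T := TB) (x := φ.1) (stalkIdeal_le_right _ _ a B.output φ.1) hgB
    have h2 : GermCongr ((A.comp B).stalkIdeal φ.1) (fun ψ => TA ψ)
        fun ψ => sA (A.inputMap ℂ (TA ψ)) :=
      GermCongr.pullback (T := TA) (x := φ.1) (stalkIdeal_le_left _ _ a B.output φ.1) hgA
    -- At glued vertices this is the congruence for `B`; at the other inputs of `A` it is an
    -- equality. Substituting into the analytic section `sA` then gives the congruence for `A`.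
    have h3 : GermCongr ((A.comp B).stalkIdeal φ.1) (fun ψ => A.inputMap ℂ (TA ψ))
        fun ψ => q (p ψ) := by
      refine GermCongr.pi fun x => ?_
      rcases x with t | r
      · have := h1.clm_comp (ContinuousLinearMap.proj (R := ℝ) (φ := fun _ : B.V => ℂ)
          (B.output t))
        refine (GermCongr.of_eventuallyEq (Eventually.of_forall fun ψ => ?_)).trans this
        exact (inputMap_complex_apply A (TA ψ) _).trans (congrArg ψ
          (glue_eq A.toMarkedLinkage B.toMarkedLinkage a B.output t))
      · refine GermCongr.of_eventuallyEq (Eventually.of_forall fun ψ => ?_)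
        exact (inputMap_complex_apply A (TA ψ) _).trans (RCLike.map_map_complex (hρ r) _).symm
    have h4 : GermCongr ((A.comp B).stalkIdeal φ.1) (fun ψ => sA (A.inputMap ℂ (TA ψ)))
        fun ψ => sA (q (p ψ)) :=
      h3.analyticAt_comp (((A.inputMap ℂ).comp TA).analyticAt φ.1)
        (AnalyticAt.comp (g := q) (f := p) hq (p.analyticAt φ.1)) hqz hsA
    have h5 := h2.trans h4
    have hp : ∀ᶠ ψ in 𝓝 φ.1, ∀ x, s (p ψ) (Quot.mk _ x) =
        Sum.elim (sA (q (p ψ))) (sB (π (p ψ))) x :=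
      (p.continuous.tendsto φ.1).eventually hglue
    refine GermCongr.pi fun v => ?_
    refine glueV_cases A.toMarkedLinkage B.toMarkedLinkage a B.output
      (p := fun v => GermCongr ((A.comp B).stalkIdeal φ.1) (fun ψ => ψ v) fun ψ => s (p ψ) v)
      (fun v => ?_) (fun v => ?_) v
    · refine (h5.clm_comp (ContinuousLinearMap.proj (R := ℝ) (φ := fun _ : A.V => ℂ) v)).trans
        (GermCongr.of_eventuallyEq ?_)
      filter_upwards [hp] with ψ hψ
      exact (hψ (Sum.inl v)).symm
    · refine (h1.clm_comp (ContinuousLinearMap.proj (R := ℝ) (φ := fun _ : B.V => ℂ) v)).trans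
        (GermCongr.of_eventuallyEq ?_)
      filter_upwards [hp] with ψ hψ
      exact (hψ (Sum.inr v)).symm

theorem crit_comp_subset (hρ : ρ → (RCLike.I : 𝕜) ≠ 0) : (A.comp B).crit 𝕜 ⊆
    {φ | resA A B φ ∈ A.crit ℂ} ∪ {φ | resB A B φ ∈ B.crit 𝕜} := by
  intro φ hφ
  by_contra hno
  rw [Set.mem_union, not_or] at hno
  exact hφ (isRegularAt_comp hρ (not_not.1 hno.1) (not_not.1 hno.2))

/-- Regular realizations over `x` and `y` can be chosen independently, since any two realizations
with compatible inputs glue. -/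
theorem mem_comp_domStar {c : FunctionClass} {GB : Subgroup (Equiv.Perm B.config)}
    {g : (ι → 𝕜) → τ → ℂ} (hρ : ρ → (RCLike.I : 𝕜) ≠ 0) (hB : B.ComputesWithGroup 𝕜 c GB g)
    {x : τ ⊕ ρ → ℂ} (hx : x ∈ A.domStar ℂ) {y : ι → 𝕜} (hy : y ∈ B.domStar 𝕜)
    (hxy : (fun t => x (Sum.inl t)) = g y) :
    (Sum.elim y fun r => RCLike.map ℂ 𝕜 (x (Sum.inr r))) ∈ (A.comp B).domStar 𝕜 := by
  obtain ⟨φ, hφ, rfl⟩ := hx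
  obtain ⟨ψ, hψ, rfl⟩ := hy
  obtain ⟨η, rfl, rfl⟩ := exists_comp_config_of_inputMap hB (congrFun hxy)
  refine ⟨η, fun hη => ?_, inputMap_comp η⟩
  rcases crit_comp_subset hρ hη with h | h
  exacts [hφ h, hψ h]

end IOLinkage

end

/-! ### The functionality theorem -/

theorem mainTheorem7 {𝕜 : Type} [RCLike 𝕜] {ι τ ρ κ : Type} [Fintype ι] [Fintype τ] [Fintype ρ]
    (hρ : ¬ IsAlgClosed 𝕜 → IsEmpty ρ) (c : FunctionClass)
    (A : IOLinkage (τ ⊕ ρ) κ) (B : IOLinkage ι τ)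
    (GA : Subgroup (Equiv.Perm A.config)) (GB : Subgroup (Equiv.Perm B.config))
    (f : (τ ⊕ ρ → ℂ) → κ → ℂ) (g : (ι → 𝕜) → τ → ℂ)
    (hA : A.IsFunctional ℂ c GA f) (hB : B.IsFunctional 𝕜 c GB g)
    (hint : ∃ y ∈ interior (B.dom 𝕜), ∃ x ∈ interior (A.dom ℂ),
      (fun t => x (Sum.inl t)) = g y) :
    -- the configuration scheme of the composition is the fiber product
    IsPullback (MarkedLinkage.schemeLeft A.toMarkedLinkage B.toMarkedLinkage
        (Function.Embedding.inl.trans A.input) B.output)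
      (MarkedLinkage.schemeRight A.toMarkedLinkage B.toMarkedLinkage
        (Function.Embedding.inl.trans A.input) B.output)
      (MarkedLinkage.schemeEval fun t => A.input (Sum.inl t))
      (MarkedLinkage.schemeEval fun t => B.output t) ∧
    -- the domain of the composition is the fiber product of the domains
    (∃ θ : IOLinkage.domProduct 𝕜 A B g ≃ₜ (A.comp B).dom 𝕜, IsSemialgebraicIso θ ∧
      ∀ z, (θ z : ι ⊕ ρ → 𝕜) =
        Sum.elim z.1.2 fun r => RCLike.map ℂ 𝕜 (z.1.1 (Sum.inr r))) ∧
    -- functionality for the composed function, symmetry group and walls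
    (∃ G : Subgroup (Equiv.Perm (A.comp B).config),
      (A.comp B).ComputesWithGroup 𝕜 c G (fun z => f (Sum.elim (g fun i => z (Sum.inl i))
        fun r => RCLike.map 𝕜 ℂ (z (Sum.inr r)))) ∧
      (∀ σ, σ ∈ G ↔ ∃ σ' ∈ GA, ∃ σ'' ∈ GB, ∀ φ,
        IOLinkage.resA A B (σ φ) = σ' (IOLinkage.resA A B φ) ∧
          IOLinkage.resB A B (σ φ) = σ'' (IOLinkage.resB A B φ)) ∧
      ((∃ z ∈ IOLinkage.domProduct 𝕜 A B g,
          z.1 ∉ A.wallInDom ℂ GA ∧ z.2 ∉ B.wallInDom 𝕜 GB) →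
        (∃ e : G ≃* GA × GB, ∀ (σ : G) (φ : (A.comp B).config),
          IOLinkage.resA A B (σ.1 φ) = (e σ).1.1 (IOLinkage.resA A B φ) ∧
            IOLinkage.resB A B (σ.1 φ) = (e σ).2.1 (IOLinkage.resB A B φ)) ∧
        (A.comp B).wall G = {φ | IOLinkage.resA A B φ ∈ A.wall GA} ∪
          {φ | IOLinkage.resB A B φ ∈ B.wall GB}) ∧
      (Dense {z : IOLinkage.domProduct 𝕜 A B g |
          z.1.1 ∉ A.wallInDom ℂ GA ∧ z.1.2 ∉ B.wallInDom 𝕜 GB} →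
        (A.comp B).IsFunctional 𝕜 c G (fun z => f (Sum.elim (g fun i => z (Sum.inl i))
          fun r => RCLike.map 𝕜 ℂ (z (Sum.inr r)))))) ∧
    -- the critical set
    (A.comp B).crit 𝕜 ⊆ {φ | IOLinkage.resA A B φ ∈ A.crit ℂ} ∪
      {φ | IOLinkage.resB A B φ ∈ B.crit 𝕜} ∧
    -- the regular part of the domain
    (∀ x ∈ A.domStar ℂ, ∀ y ∈ B.domStar 𝕜, (fun t => x (Sum.inl t)) = g y →
      (Sum.elim y fun r => RCLike.map ℂ 𝕜 (x (Sum.inr r))) ∈ (A.comp B).domStar 𝕜) ∧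
    (∀ h : IsEmpty ρ,
      {z : ι ⊕ ρ → 𝕜 | (fun i => z (Sum.inl i)) ∈ B.domStar 𝕜} ∩
        {z | Sum.elim (g fun i => z (Sum.inl i)) (fun r => h.elim r) ∈ A.domStar ℂ} ⊆
          (A.comp B).domStar 𝕜) := by

  -- An unglued input of `A` forces `𝕜` to be algebraically closed; over the reals there is none and
  -- the condition is vacuous.
  have hρ' : ρ → (RCLike.I : 𝕜) ≠ 0 := fun r => by
    by_cases h : IsAlgClosed 𝕜
    · exact RCLike.I_ne_zero_of_isAlgClosed 𝕜
    · exact ((hρ h).false r).elim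
  have hA' := hA.toComputesWithGroup
  have hB' := hB.toComputesWithGroup
  have hstar : ∀ x ∈ A.domStar ℂ, ∀ y ∈ B.domStar 𝕜, (fun t => x (Sum.inl t)) = g y →
      (Sum.elim y fun r => RCLike.map ℂ 𝕜 (x (Sum.inr r))) ∈ (A.comp B).domStar 𝕜 :=
    fun x hx y hy hxy => IOLinkage.mem_comp_domStar hρ' hB' hx hy hxy
  refine ⟨MarkedLinkage.isPullback_fiberSum _ _ _ _,
    ⟨IOLinkage.domHomeomorph hρ' hB', IOLinkage.isSemialgebraicIso_domHomeomorph hρ' hB',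
      fun z => rfl⟩, ?_, IOLinkage.crit_comp_subset hρ', hstar, fun h z hz => ?_⟩
  · obtain ⟨Φ, hΦ⟩ := IOLinkage.exists_symmetryHom hA' hB'
    have hcomp := IOLinkage.computesWithGroup_comp hΦ hρ' hA' hB' hint
    refine ⟨Φ.range, hcomp, IOLinkage.mem_range_symmetryHom hΦ, fun hD => ?_, fun hD =>
      ⟨hcomp, IOLinkage.wall_nowhereDense_comp hΦ hA' hB' hcomp.isClosed_wall hD⟩⟩
    have hinj := IOLinkage.symmetryHom_injective hΦ
      (IOLinkage.exists_notMem_wall_of_domProduct hB' hD)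
    refine ⟨⟨(MonoidHom.ofInjective hinj).symm, fun σ φ => ?_⟩,
      IOLinkage.wall_comp_of_injective hΦ hinj⟩
    have := hΦ ((MonoidHom.ofInjective hinj).symm σ) φ
    rwa [MonoidHom.apply_ofInjective_symm] at this
  · have := hstar _ hz.2 _ hz.1 rfl
    convert this using 1
    funext x
    rcases x with i | r
    · rfl
    · exact h.elim r
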